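/- Fix an o-minimal structure on the real field $(\mathbb R,+,\cdot)$; "definable" means definable in it with real parameters. A $C^2$ submanifold of $\mathbb R^n$ is an embedded one, of some constant dimension and not necessarily closed. For linear subspaces $A,B\subset\mathbb R^n$ and $v\in\mathbb R^n$ put $\eta(v,B)=\sup\{\langle v,m\rangle : m\in B^{\perp},\ \|m\|=1\}$ and $d(A,B)=\sup\{\eta(v,B): v\in A,\ \|v\|=1\}$ (a supremum over the empty set being $0$). Let $X,Y\subset\mathbb R^n$ be disjoint $C^2$ submanifolds, let $p\in X$, and let $\pi$ be a local retraction onto $X$ near $p$ (the nearest point retraction, or any retraction of class $C^1$). For $y\in Y$ near $p$ put $$\alpha(y)=d(T_{\pi(y)}X,T_yY),\qquad \beta(y)=\eta\Big(\tfrac{\pi(y)-y}{\|\pi(y)-y\|},T_yY\Big),\qquad R(y)=\frac{\|y-p\|\,\alpha(y)}{\|y-\pi(y)\|}.$$ The pair $(Y,X)$ satisfies at $p$: Whitney's condition $(b)$ if $\alpha(y)\to0$ and $\beta(y)\to 0$ as $y\to p$, $y\in Y$; Kuo's ratio test $(r)$ if $R(y)\to0$ as $y\to p$, $y\in Y$;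 the Kuo–Verdier condition $(w)$ if $d(T_xX,T_yY)/\|x-y\|$ is bounded for $y\in Y$, $x\in X$ near $p$. 1. If $X$ and $Y$ are disjoint definable $C^2$ submanifolds of $\mathbb R^n$, of any dimensions, and $(Y,X)$ satisfies $(r)$ at $p\in X$, then $(Y,X)$ satisfies $(b)$ at $p$ (with respect to the same $\pi$). 2. Consequently $(w)$ implies $(b)$ for definable stratifications: if a set $S\subset\mathbb R^n$ is partitioned into a locally finite family of definable $C^2$ submanifolds (strata), and $X\neq Y$ are strata such that $(Y,X)$ satisfies $(w)$ at $p\in X$, then $(Y,X)$ satisfies $(b)$ at $p$ (for every local retraction $\pi$ as above). -/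

import Mathlib

open Set Filter Topology

universe u v

noncomputable section

namespace Strata

/-- Euclidean space `ℝⁿ`. -/
abbrev E (n : ℕ) : Type := EuclideanSpace ℝ (Fin n)

/-! ### O-minimal structures on the real field -/

/-- The first-order structure `L` on `ℝ` is an o-minimal structure on the real field: addition and
multiplication are definable (hence so is the order), and every definable subset of `ℝ` is a finite
union of intervals (of any kind, points included). Definability is with real parameters. The
order-connected subsets of `ℝ` are exactly the intervals. -/
structure IsOMinimal (L : FirstOrder.Language.{u, v}) [L.Structure ℝ] : Prop where
  add_definable : (univ : Set ℝ).Definable L {w : Fin 3 → ℝ | w 0 + w 1 = w 2}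
  mul_definable : (univ : Set ℝ).Definable L {w : Fin 3 → ℝ | w 0 * w 1 = w 2}
  finite_union_intervals : ∀ s : Set ℝ, (univ : Set ℝ).Definable₁ L s →
    ∃ F : Set (Set ℝ), F.Finite ∧ (∀ I ∈ F, I.OrdConnected) ∧ s = ⋃₀ F

/-- A subset of `ℝⁿ` is definable (with real parameters) in the structure `L`. -/
def IsDefinable (L : FirstOrder.Language.{u, v}) [L.Structure ℝ] {n : ℕ} (A : Set (E n)) : Prop :=
  (univ : Set ℝ).Definable L {w : Fin n → ℝ | WithLp.toLp 2 w ∈ A}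

/-! ### Submanifolds and tangent spaces -/

/-- `M` is a (not necessarily closed) embedded `C²` submanifold of `ℝⁿ` of dimension `d`: near each
of its points a `C²` diffeomorphism between open sets straightens it to a `d`-dimensional linear
subspace. -/
def IsC2Submanifold {n : ℕ} (d : ℕ) (M : Set (E n)) : Prop :=
  ∀ p ∈ M, ∃ (φ : OpenPartialHomeomorph (E n) (E n)) (V : Submodule ℝ (E n)),
    p ∈ φ.source ∧ ContDiffOn ℝ 2 φ φ.source ∧ ContDiffOn ℝ 2 φ.symm φ.target ∧
    Module.finrank ℝ V = d ∧ ∀ x ∈ φ.source, x ∈ M ↔ φ x ∈ V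

/-- The tangent space `T_p M`, as a linear subspace of `ℝⁿ`. (For a submanifold the tangent cone is
already a linear space.) -/
def tangent {n : ℕ} (M : Set (E n)) (p : E n) : Submodule ℝ (E n) :=
  Submodule.span ℝ (tangentConeAt ℝ M p)

/-- `π` is the canonical (nearest point) retraction onto `X` near `p`. -/
def IsNearestPointRetraction {n : ℕ} (X : Set (E n)) (p : E n) (π : E n → E n) : Prop :=
  ∀ᶠ y in 𝓝 p, π y ∈ X ∧ dist y (π y) = Metric.infDist y X

/-- `π` is a retraction of class `C¹` onto `X` near `p`. -/
def IsC1Retraction {n : ℕ} (X : Set (E n)) (p : E n) (π : E n → E n) : Prop :=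
  ContDiffAt ℝ 1 π p ∧ ∀ᶠ y in 𝓝 p, π y ∈ X ∧ (y ∈ X → π y = y)

/-- Local retractions onto `X` near `p`: the canonical one, or any one of class `C¹`. -/
def IsLocalRetraction {n : ℕ} (X : Set (E n)) (p : E n) (π : E n → E n) : Prop :=
  IsNearestPointRetraction X p π ∨ IsC1Retraction X p π

/-! ### Angles between vectors and subspaces -/

/-- The distance of a vector `v` to a subspace `B`, as the supremum of `⟨v, m⟩` over the unit
normals `m` of `B` (equal to `0` if `B` is the whole space, where there are none). -/
def eta {n : ℕ} (v : E n) (B : Submodule ℝ (E n)) : ℝ :=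
  sSup {r : ℝ | ∃ m ∈ Bᗮ, ‖m‖ = 1 ∧ r = inner ℝ v m}

/-- `d(A, B) = sup {η(v, B) : v ∈ A, ‖v‖ = 1}` (equal to `0` if `A = 0`). -/
def subspaceDist {n : ℕ} (A B : Submodule ℝ (E n)) : ℝ :=
  sSup {r : ℝ | ∃ v ∈ A, ‖v‖ = 1 ∧ r = eta v B}

/-- `α_{Y,X}(y) = d(T_{π(y)} X, T_y Y)`. -/
def alpha {n : ℕ} (Y X : Set (E n)) (π : E n → E n) (y : E n) : ℝ :=
  subspaceDist (tangent X (π y)) (tangent Y y)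

/-- `β_{Y,X}(y)`: the distance to `T_y Y` of the unit vector in the direction `π(y) - y`. -/
def beta {n : ℕ} (Y : Set (E n)) (π : E n → E n) (y : E n) : ℝ :=
  eta (‖π y - y‖⁻¹ • (π y - y)) (tangent Y y)

/-- Kuo's ratio, based at the point `p` of `X`. -/
def kuoRatio {n : ℕ} (Y X : Set (E n)) (p : E n) (π : E n → E n) (y : E n) : ℝ :=
  ‖y - p‖ * alpha Y X π y / ‖π y - y‖

/-- The Kuo-Verdier ratio. -/
def verdierRatio {n : ℕ} (Y X : Set (E n)) (y x : E n) : ℝ :=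
  subspaceDist (tangent X x) (tangent Y y) / ‖x - y‖

/-! ### Regularity conditions for the pair `(Y, X)` at `p ∈ X` -/

/-- Whitney's condition (b). -/
def ConditionB {n : ℕ} (Y X : Set (E n)) (p : E n) (π : E n → E n) : Prop :=
  Tendsto (alpha Y X π) (𝓝[Y] p) (𝓝 0) ∧ Tendsto (beta Y π) (𝓝[Y] p) (𝓝 0)

/-- Kuo's ratio test (r). -/
def ConditionR {n : ℕ} (Y X : Set (E n)) (p : E n) (π : E n → E n) : Prop :=
  Tendsto (kuoRatio Y X p π) (𝓝[Y] p) (𝓝 0)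

/-- The Kuo-Verdier condition (w). -/
def ConditionW {n : ℕ} (Y X : Set (E n)) (p : E n) : Prop :=
  ∃ C : ℝ, ∃ U ∈ 𝓝 p, ∀ y ∈ Y ∩ U, ∀ x ∈ X ∩ U, verdierRatio Y X y x ≤ C

/-! ### Definable stratifications -/

/-- `S` is partitioned into a locally finite family of `C²` submanifolds, the strata, which are
definable in `L`. -/
structure IsDefinableStratification (L : FirstOrder.Language.{u, v}) [L.Structure ℝ] {n : ℕ}
    (S : Set (E n)) (strata : Set (Set (E n))) : Prop where
  sUnion_eq : ⋃₀ strata = S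
  pairwise_disjoint : ∀ X ∈ strata, ∀ Y ∈ strata, X ≠ Y → Disjoint X Y
  locally_finite : ∀ p : E n, ∃ U ∈ 𝓝 p, {X ∈ strata | (X ∩ U).Nonempty}.Finite
  submanifold : ∀ X ∈ strata, ∃ d : ℕ, IsC2Submanifold d X
  definable : ∀ X ∈ strata, IsDefinable L X

end Strata

end

/-!
That `α` tends to `0` is immediate from the ratio test, so let `β` not tend to `0`. Definable curve
selection gives definable curves `y(t)` in `Y` with `‖y - p‖ = t`, `x(t)` in `X` and a unit normal
`m(t)` of `T_y Y` such that the secant `q = x - y` satisfies `ε‖q‖ ≤ ⟨q, m⟩`. The normals converge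
to some `m₀`, and `H = ⟨q, m₀⟩` dominates `‖q‖`. Monotonicity of definable germs turns bounds on
functions into bounds on derivatives: `‖q'‖ = O(H')`, and `H ≤ 2tH'` because `H = O(t)`. As `m` is
close to `m₀`, this gives `‖q‖ = O(t⟨q', m⟩)`. But `y'` is tangent to `Y`, so
`⟨q', m⟩ = ⟨x', m⟩ ≤ ‖x'‖ d(T_x X, T_y Y)` with `x'` bounded, and the ratio
`t d(T_x X, T_y Y) / ‖q‖` stays away from zero.
-/

namespace Strata

/-! ### Definable predicates and functions -/

section Definability

variable {L : FirstOrder.Language.{u, v}} [L.Structure ℝ] {α β γ : Type*} {n : ℕ}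

/-- A predicate on tuples of reals that is definable with real parameters. -/
def DefPred (L : FirstOrder.Language.{u, v}) [L.Structure ℝ] (P : (α → ℝ) → Prop) : Prop :=
  (univ : Set ℝ).Definable L {w | P w}

/-- A real function of tuples of reals whose graph is definable with real parameters. -/
def DefFun (L : FirstOrder.Language.{u, v}) [L.Structure ℝ] (f : (α → ℝ) → ℝ) : Prop :=
  (univ : Set ℝ).DefinableFun L f

/-- A definable relation between two blocks of variables, that is, a definable family of sets of
`β`-tuples indexed by `α`-tuples. -/
abbrev DefRel (L : FirstOrder.Language.{u, v}) [L.Structure ℝ]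
    (S : (α → ℝ) → (β → ℝ) → Prop) : Prop :=
  DefPred L fun w : α ⊕ β → ℝ => S (fun a => w (.inl a)) (fun b => w (.inr b))

/-- A definable family of sets of real numbers. -/
abbrev DefFamily (L : FirstOrder.Language.{u, v}) [L.Structure ℝ] (S : (α → ℝ) → ℝ → Prop) : Prop :=
  DefPred L fun w : α ⊕ Fin 1 → ℝ => S (fun a => w (.inl a)) (w (.inr 0))

/-- A map from tuples of reals to `ℝⁿ` with definable coordinates. -/
def DefVec (L : FirstOrder.Language.{u, v}) [L.Structure ℝ] (f : (α → ℝ) → E n) : Prop :=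
  ∀ i, DefFun L fun w => f w i

/-- A definable property of a single real number. -/
abbrev DefPred₁ (L : FirstOrder.Language.{u, v}) [L.Structure ℝ] (P : ℝ → Prop) : Prop :=
  DefPred L fun w : Fin 1 → ℝ => P (w 0)

/-- A definable real function of one real variable. -/
abbrev DefFun₁ (L : FirstOrder.Language.{u, v}) [L.Structure ℝ] (F : ℝ → ℝ) : Prop :=
  DefFun L fun w : Fin 1 → ℝ => F (w 0)

/-- A definable curve in `ℝⁿ`. -/
abbrev DefCurve (L : FirstOrder.Language.{u, v}) [L.Structure ℝ] (γ : ℝ → E n) : Prop :=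
  DefVec L fun w : Fin 1 → ℝ => γ (w 0)

namespace DefPred

variable {P Q : (α → ℝ) → Prop}

theorem and (hP : DefPred L P) (hQ : DefPred L Q) : DefPred L fun w => P w ∧ Q w :=
  hP.inter hQ

theorem or (hP : DefPred L P) (hQ : DefPred L Q) : DefPred L fun w => P w ∨ Q w :=
  hP.union hQ

theorem not (hP : DefPred L P) : DefPred L fun w => ¬ P w :=
  hP.compl

theorem congr (hP : DefPred L P) (h : ∀ w, P w ↔ Q w) : DefPred L Q :=
  (funext fun w => propext (h w) : P = Q) ▸ hP

theorem imp (hP : DefPred L P) (hQ : DefPred L Q) : DefPred L fun w => P w → Q w :=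
  (hP.not.or hQ).congr fun _ => imp_iff_not_or.symm

theorem comp [Finite β] {P : (β → ℝ) → Prop} (hP : DefPred L P) {F : (α → ℝ) → β → ℝ}
    (hF : ∀ b, DefFun L fun v => F v b) : DefPred L fun v => P (F v) :=
  Set.Definable.preimage_map hF hP

theorem comp₁ {P : ℝ → Prop} (hP : DefPred₁ L P) {f : (α → ℝ) → ℝ} (hf : DefFun L f) :
    DefPred L fun w => P (f w) :=
  hP.comp (F := fun w _ => f w) fun _ => hf

theorem rel [Finite α] [Finite β] {S : (α → ℝ) → (β → ℝ) → Prop} (hS : DefRel L S)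
    {f : (γ → ℝ) → α → ℝ} {g : (γ → ℝ) → β → ℝ} (hf : ∀ a, DefFun L fun v => f v a)
    (hg : ∀ b, DefFun L fun v => g v b) : DefPred L fun v => S (f v) (g v) :=
  hS.comp (F := fun v => Sum.elim (f v) (g v)) (Sum.rec hf hg)

theorem family [Finite α] {S : (α → ℝ) → ℝ → Prop} (hS : DefFamily L S)
    {f : (γ → ℝ) → α → ℝ} {g : (γ → ℝ) → ℝ} (hf : ∀ a, DefFun L fun v => f v a)
    (hg : DefFun L g) : DefPred L fun v => S (f v) (g v) :=
  rel (S := fun v (z : Fin 1 → ℝ) => S v (z 0)) hS (g := fun v _ => g v) hf fun _ => hg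

theorem exists_tuple [Finite β] {S : (α → ℝ) → (β → ℝ) → Prop} (hS : DefRel L S) :
    DefPred L fun v => ∃ z, S v z :=
  Set.Definable.exists_of_finite (S := {_w : α ⊕ β → ℝ | _}) hS

theorem exists_real {S : (α → ℝ) → ℝ → Prop} (hS : DefFamily L S) : DefPred L fun v => ∃ x, S v x :=
  (exists_tuple (S := fun v (z : Fin 1 → ℝ) => S v (z 0)) hS).congr fun _ =>
    ⟨fun ⟨z, hz⟩ => ⟨z 0, hz⟩, fun ⟨x, hx⟩ => ⟨fun _ => x, hx⟩⟩

theorem forall_real {S : (α → ℝ) → ℝ → Prop} (hS : DefFamily L S) : DefPred L fun v => ∀ x, S v x :=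
  (exists_real (S := fun v x => ¬ S v x) hS.not).not.congr fun _ => not_exists_not

theorem exists_vec {S : (α → ℝ) → E n → Prop}
    (hS : DefRel L fun v (z : Fin n → ℝ) => S v (WithLp.toLp 2 z)) :
    DefPred L fun v => ∃ x, S v x :=
  hS.exists_tuple.congr fun _ => ⟨fun ⟨_, hz⟩ => ⟨_, hz⟩, fun ⟨x, hx⟩ => ⟨x.ofLp, hx⟩⟩

theorem forall_vec {S : (α → ℝ) → E n → Prop}
    (hS : DefRel L fun v (z : Fin n → ℝ) => S v (WithLp.toLp 2 z)) :
    DefPred L fun v => ∀ x, S v x :=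
  (exists_vec (S := fun v x => ¬ S v x) hS.not).not.congr fun _ => not_exists_not

end DefPred

theorem IsDefinable.mem {X : Set (E n)} (hX : IsDefinable L X) {f : (α → ℝ) → E n}
    (hf : DefVec L f) : DefPred L fun w => f w ∈ X :=
  DefPred.comp (P := fun w : Fin n → ℝ => WithLp.toLp 2 w ∈ X) hX hf

/-- The structure `L` defines the addition and the multiplication of the reals. -/
class ExpandsRealField (L : FirstOrder.Language.{u, v}) [L.Structure ℝ] : Prop where
  add_definable : (univ : Set ℝ).Definable L {w : Fin 3 → ℝ | w 0 + w 1 = w 2}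
  mul_definable : (univ : Set ℝ).Definable L {w : Fin 3 → ℝ | w 0 * w 1 = w 2}

theorem IsOMinimal.expandsRealField (hL : IsOMinimal L) : ExpandsRealField L :=
  ⟨hL.add_definable, hL.mul_definable⟩

namespace DefFun

variable {f g : (α → ℝ) → ℝ}

theorem comp [Finite β] {f : (β → ℝ) → ℝ} (hf : DefFun L f) {F : (α → ℝ) → β → ℝ}
    (hF : ∀ b, DefFun L fun v => F v b) : DefFun L fun v => f (F v) :=
  Set.DefinableFun.comp hF hf

theorem coord (a : α) : DefFun L fun w : α → ℝ => w a :=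
  Set.DefinableFun.proj L

theorem const (c : ℝ) : DefFun L fun _ : α → ℝ => c :=
  FirstOrder.Language.definableFun_const L α (mem_univ c)

theorem eq (hf : DefFun L f) (hg : DefFun L g) : DefPred L fun w => f w = g w :=
  Set.DefinableFun.ofPred_eq hf hg

theorem ite {P : (α → ℝ) → Prop} [DecidablePred P] (hP : DefPred L P) (hf : DefFun L f)
    (hg : DefFun L g) : DefFun L fun w => if P w then f w else g w :=
  Set.DefinableFun.ite hP hf hg

theorem of_graph (h : DefPred L fun w : Option α → ℝ => f (fun a => w (some a)) = w none) :
    DefFun L f :=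
  h

theorem comp₁ {F : ℝ → ℝ} (hF : DefFun₁ L F) (hf : DefFun L f) : DefFun L fun w => F (f w) :=
  hF.comp (F := fun w _ => f w) fun _ => hf

theorem comp_of_graph {h : ℝ → ℝ} (hh : DefPred L fun w : Fin 2 → ℝ => h (w 0) = w 1)
    (hf : DefFun L f) : DefFun L fun w => h (f w) := by
  have : DefFun₁ L h :=
    of_graph (hh.comp (F := fun w i => w (![some 0, none] i)) fun _ => coord _)
  exact this.comp₁ hf

theorem comp₂ {h : ℝ → ℝ → ℝ} (hh : DefFun L fun w : Fin 2 → ℝ => h (w 0) (w 1))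
    (hf : DefFun L f) (hg : DefFun L g) : DefFun L fun w => h (f w) (g w) :=
  hh.comp (F := fun w => ![f w, g w]) (Fin.forall_fin_two.2 ⟨hf, hg⟩)

variable [ExpandsRealField L]

theorem add (hf : DefFun L f) (hg : DefFun L g) : DefFun L fun w => f w + g w :=
  comp₂ (h := (· + ·)) (of_graph (DefPred.comp (P := fun w : Fin 3 → ℝ => w 0 + w 1 = w 2)
    ExpandsRealField.add_definable (F := fun w i => w (![some 0, some 1, none] i))
    fun _ => coord _)) hf hg

theorem mul (hf : DefFun L f) (hg : DefFun L g) : DefFun L fun w => f w * g w :=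
  comp₂ (h := (· * ·)) (of_graph (DefPred.comp (P := fun w : Fin 3 → ℝ => w 0 * w 1 = w 2)
    ExpandsRealField.mul_definable (F := fun w i => w (![some 0, some 1, none] i))
    fun _ => coord _)) hf hg

theorem neg (hf : DefFun L f) : DefFun L fun w => -f w := by
  simpa only [neg_one_mul] using (const (-1)).mul hf

theorem sub (hf : DefFun L f) (hg : DefFun L g) : DefFun L fun w => f w - g w := by
  simpa only [sub_eq_add_neg] using hf.add hg.neg

theorem le (hf : DefFun L f) (hg : DefFun L g) : DefPred L fun w => f w ≤ g w := by
  have h : DefPred L fun w : Fin 2 → ℝ => w 0 ≤ w 1 := by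
    refine (DefPred.exists_real (S := fun w z => w 0 + z * z = w 1)
      (((coord _).add ((coord _).mul (coord _))).eq (coord _))).congr fun w => ⟨?_, fun h => ?_⟩
    · rintro ⟨z, hz⟩
      exact hz ▸ le_add_of_nonneg_right (mul_self_nonneg z)
    · exact ⟨√(w 1 - w 0), by rw [Real.mul_self_sqrt (sub_nonneg.2 h), add_sub_cancel]⟩
  exact h.comp (F := fun w => ![f w, g w]) (Fin.forall_fin_two.2 ⟨hf, hg⟩)

theorem lt (hf : DefFun L f) (hg : DefFun L g) : DefPred L fun w => f w < g w :=
  (hg.le hf).not.congr fun _ => not_le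

theorem abs (hf : DefFun L f) : DefFun L fun w => |f w| := by
  classical
  have h : ∀ x : ℝ, (if 0 ≤ x then x else -x) = |x| := fun x => by
    split_ifs with hx
    exacts [(abs_of_nonneg hx).symm, (abs_of_neg (not_le.1 hx)).symm]
  simpa only [h] using ite ((const 0).le hf) hf hf.neg

theorem inv (hf : DefFun L f) : DefFun L fun w => (f w)⁻¹ := by
  refine comp_of_graph (h := fun x => x⁻¹) ((((coord 0).mul (coord 1)).eq (const 1)).or
    (((coord 0).eq (const 0)).and ((coord 1).eq (const 0))) |>.congr
      fun w => ⟨?_, fun h => ?_⟩) hf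
  · rintro (h | ⟨h, h'⟩)
    · exact inv_eq_of_mul_eq_one_right h
    · rw [h, h', inv_zero]
  · rw [← h]
    exact (eq_or_ne (w 0) 0).symm.imp mul_inv_cancel₀ fun h0 => ⟨h0, by rw [h0, inv_zero]⟩

theorem sqrt (hf : DefFun L f) : DefFun L fun w => √(f w) := by
  refine comp_of_graph (h := fun x => √x)
    ((((const 0).le (coord 1)).and (((coord 1).mul (coord 1)).eq (coord 0))).or
      (((coord 0).lt (const 0)).and ((coord 1).eq (const 0))) |>.congr
        fun w => ⟨?_, fun h => ?_⟩) hf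
  · rintro (⟨h, h'⟩ | ⟨h, h'⟩)
    · rw [← h', Real.sqrt_mul_self h]
    · rw [h', Real.sqrt_eq_zero_of_nonpos h.le]
  · rw [← h]
    exact (le_or_gt 0 (w 0)).imp (fun h0 => ⟨Real.sqrt_nonneg _, Real.mul_self_sqrt h0⟩)
      fun h0 => ⟨h0, Real.sqrt_eq_zero_of_nonpos h0.le⟩

theorem sum {ι : Type*} (s : Finset ι) {f : ι → (α → ℝ) → ℝ} (hf : ∀ i, DefFun L (f i)) :
    DefFun L fun w => ∑ i ∈ s, f i w := by
  classical
  induction s using Finset.induction_on with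
  | empty => simpa only [Finset.sum_empty] using const 0
  | insert i s hi ih => simpa only [Finset.sum_insert hi] using (hf i).add ih

variable [Finite α] {S : (α → ℝ) → ℝ → Prop}

theorem isGLB (hS : DefFamily L S) : DefFamily L fun v b => IsGLB {z | S v z} b := by
  let IsLower (v : α → ℝ) (b : ℝ) : Prop := ∀ z, S v z → b ≤ z
  have hLower : DefFamily L IsLower :=
    .forall_real (.imp (.family hS (fun _ => coord _) (coord _)) ((coord _).le (coord _)))
  refine (hLower.and (.forall_real (S := fun w b => IsLower (fun a => w (.inl a)) b →
    b ≤ w (.inr 0)) (.imp (.family hLower (fun _ => coord _) (coord _)) ?_))).congr fun w => ?_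
  · exact (coord _).le (coord _)
  · exact .rfl

protected theorem sInf (hS : DefFamily L S) : DefFun L fun v => sInf {z | S v z} := by
  have hGLB := isGLB hS
  refine of_graph (DefPred.congr (P := fun w : Option α → ℝ =>
    IsGLB {z | S (fun a => w (some a)) z} (w none) ∨
      (¬ ∃ b, IsGLB {z | S (fun a => w (some a)) z} b) ∧ w none = 0) ?_ fun w => ?_)
  · exact (hGLB.family (fun _ => coord _) (coord _)).or
      (((DefPred.exists_real hGLB).comp fun _ => coord _).not.and ((coord _).eq (const 0)))
  · set A := {z | S (fun a => w (some a)) z}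
    have hA : ¬ (∃ b, IsGLB A b) → sInf A = 0 := fun h => by
      by_cases hne : A.Nonempty
      · exact Real.sInf_of_not_bddBelow fun hbdd => h ⟨_, isGLB_csInf hne hbdd⟩
      · rw [not_nonempty_iff_eq_empty.1 hne, Real.sInf_empty]
    constructor
    · rintro (h | ⟨h, h0⟩)
      exacts [h.csInf_eq h.nonempty, (hA h).trans h0.symm]
    · rintro h
      by_cases hex : ∃ b, IsGLB A b
      · obtain ⟨b, hb⟩ := hex
        exact .inl (h ▸ isGLB_csInf hb.nonempty ⟨b, hb.1⟩)
      · exact .inr ⟨hex, h.symm.trans (hA hex)⟩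

protected theorem sSup (hS : DefFamily L S) : DefFun L fun v => sSup {z | S v z} := by
  have h : DefFamily L fun v z => S v (-z) := hS.family (fun _ => coord _) (coord _).neg
  have hneg : ∀ v, -sInf {z | S v (-z)} = sSup {z | S v z} := fun v => by
    rw [show {z | S v (-z)} = -{z | S v z} from rfl, Real.sInf_neg, neg_neg]
  simpa only [hneg] using (DefFun.sInf h).neg

end DefFun

namespace DefVec

variable {f g : (α → ℝ) → E n}

theorem tuple (c : Fin n → α) : DefVec L fun w : α → ℝ => WithLp.toLp 2 fun i => w (c i) :=
  fun i => .coord (c i)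

theorem const (c : E n) : DefVec L fun _ : α → ℝ => c :=
  fun i => .const (c i)

theorem comp [Finite β] {f : (β → ℝ) → E n} (hf : DefVec L f) {F : (α → ℝ) → β → ℝ}
    (hF : ∀ b, DefFun L fun v => F v b) : DefVec L fun v => f (F v) :=
  fun i => (hf i).comp hF

variable [ExpandsRealField L]

theorem add (hf : DefVec L f) (hg : DefVec L g) : DefVec L fun w => f w + g w :=
  fun i => (hf i).add (hg i)

theorem sub (hf : DefVec L f) (hg : DefVec L g) : DefVec L fun w => f w - g w :=
  fun i => (hf i).sub (hg i)

theorem smul {c : (α → ℝ) → ℝ} (hc : DefFun L c) (hf : DefVec L f) : DefVec L fun w => c w • f w :=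
  fun i => hc.mul (hf i)

protected theorem inner (hf : DefVec L f) (hg : DefVec L g) :
    DefFun L fun w => inner ℝ (f w) (g w) := by
  simpa only [PiLp.inner_apply, RCLike.inner_apply, conj_trivial] using
    DefFun.sum Finset.univ fun i => (hg i).mul (hf i)

theorem norm (hf : DefVec L f) : DefFun L fun w => ‖f w‖ := by
  simpa only [norm_eq_sqrt_real_inner] using (hf.inner hf).sqrt

end DefVec

end Definability

/-! ### Definable choice and curve selection -/

section Choice

variable {L : FirstOrder.Language.{u, v}} [L.Structure ℝ] {α β : Type*} [Finite α]

theorem IsOMinimal.eventually_nhdsGT_or_not (hL : IsOMinimal L) {P : ℝ → Prop} (hP : DefPred₁ L P)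
    (a : ℝ) : (∀ᶠ t in 𝓝[>] a, P t) ∨ ∀ᶠ t in 𝓝[>] a, ¬ P t := by
  obtain ⟨F, hF, hI, hPF⟩ := hL.finite_union_intervals {t | P t} hP
  have hmem : ∀ t, P t ↔ ∃ I ∈ F, t ∈ I := fun t => by rw [← mem_sUnion, ← hPF, mem_ofPred]
  by_cases h : ∃ I ∈ F, ∃ᶠ t in 𝓝[>] a, t ∈ I
  · obtain ⟨I, hIF, hfr⟩ := h
    obtain ⟨b, hbI, hab⟩ := (hfr.and_eventually self_mem_nhdsWithin).exists
    left
    filter_upwards [Ioo_mem_nhdsGT hab] with t ht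
    obtain ⟨c, hcI, hc⟩ := (hfr.and_eventually (Ioo_mem_nhdsGT ht.1)).exists
    exact (hmem t).2 ⟨I, hIF, (hI I hIF).out hcI hbI ⟨hc.2.le, ht.2.le⟩⟩
  · push Not at h
    right
    filter_upwards [hF.eventually_all.2 h] with t ht hPt
    obtain ⟨I, hIF, htI⟩ := (hmem t).1 hPt
    exact ht I hIF htI

theorem IsOMinimal.eventually_nhdsLT_or_not (hL : IsOMinimal L) {P : ℝ → Prop} (hP : DefPred₁ L P)
    (a : ℝ) : (∀ᶠ t in 𝓝[<] a, P t) ∨ ∀ᶠ t in 𝓝[<] a, ¬ P t := by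
  have := hL.expandsRealField
  have hneg : Tendsto (fun t : ℝ => -t) (𝓝[<] a) (𝓝[>] (-a)) := tendsto_neg_nhdsLT
  simpa only [neg_neg] using
    (hL.eventually_nhdsGT_or_not (P := fun t => P (-t)) (hP.comp₁ (DefFun.coord 0).neg) (-a)).imp
      hneg.eventually hneg.eventually

/-- A point of a nonempty bounded definable set `S`, chosen definably: the least element of `S`, or
else the midpoint of the leftmost interval of `S`. -/
noncomputable def selectPoint (S : Set ℝ) : ℝ :=
  open Classical in
  if sInf S ∈ S then sInf S else (sInf S + sSup {s | Ioo (sInf S) s ⊆ S}) / 2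

theorem IsOMinimal.selectPoint_mem (hL : IsOMinimal L) {P : ℝ → Prop} (hP : DefPred₁ L P)
    (hne : ∃ t, P t) (hbelow : BddBelow {t | P t}) (habove : BddAbove {t | P t}) :
    P (selectPoint {t | P t}) := by
  set S := {t | P t}
  set a := sInf S
  change selectPoint S ∈ S
  unfold selectPoint
  split_ifs with ha
  · exact ha
  have hlt : ∀ t ∈ S, a < t := fun t ht =>
    (csInf_le hbelow ht).lt_of_ne fun h => ha (h ▸ ht)
  have hfreq : ∃ᶠ t in 𝓝[>] a, t ∈ S := frequently_nhdsWithin_iff.2 <|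
    (frequently_nhdsWithin_iff.1 ((isGLB_csInf hne hbelow).frequently_mem hne)).mono
      fun t ht => ⟨ht.1, hlt t ht.1⟩
  obtain ⟨s₀, hs₀, hsub⟩ := mem_nhdsGT_iff_exists_Ioo_subset.1
    ((hL.eventually_nhdsGT_or_not hP a).resolve_right hfreq)
  have hbdd : BddAbove {s | Ioo a s ⊆ S} := by
    obtain ⟨b, hb⟩ := habove
    refine ⟨max a b, fun s hs => le_of_not_gt fun hlt => ?_⟩
    obtain ⟨c, hc, hcs⟩ := exists_between hlt
    exact (hb (hs ⟨(le_max_left _ _).trans_lt hc, hcs⟩)).not_gt ((le_max_right _ _).trans_lt hc)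
  have has : a < sSup {s | Ioo a s ⊆ S} := lt_of_lt_of_le hs₀ (le_csSup hbdd hsub)
  obtain ⟨s, hs, hmid⟩ := exists_lt_of_lt_csSup ⟨s₀, hsub⟩ (add_div_two_lt_right.2 has)
  exact hs ⟨left_lt_add_div_two.2 has, hmid⟩

theorem DefFun.selectPoint [ExpandsRealField L] {S : (α → ℝ) → ℝ → Prop} (hS : DefFamily L S) :
    DefFun L fun v => selectPoint {z | S v z} := by
  classical
  have hInf := DefFun.sInf hS
  have hIoo : DefFamily L fun v s => Ioo (sInf {z | S v z}) s ⊆ {z | S v z} := by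
    refine (DefPred.forall_real (S := fun w r => sInf {z | S (fun a => w (.inl a)) z} < r →
      r < w (.inr 0) → S (fun a => w (.inl a)) r) (.imp ?_ (.imp ?_ ?_))).congr fun w => ?_
    · exact (hInf.comp fun _ => coord _).lt (coord _)
    · exact (coord _).lt (coord _)
    · exact hS.family (fun _ => coord _) (coord _)
    · exact ⟨fun h r hr => h r hr.1 hr.2, fun h r h₁ h₂ => h ⟨h₁, h₂⟩⟩
  have hmid := (hInf.add (DefFun.sSup hIoo)).mul (const 2⁻¹)
  simpa only [Strata.selectPoint, div_eq_mul_inv, mem_ofPred] using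
    ite (hS.family (fun _ => coord _) hInf) hInf hmid

theorem IsOMinimal.exists_definable_choice_real (hL : IsOMinimal L) {S : (α → ℝ) → ℝ → Prop}
    (hS : DefFamily L S) : ∃ g, DefFun L g ∧ ∀ v, (∃ z, S v z) → S v (g v) := by
  have := hL.expandsRealField
  let T (v : α → ℝ) (z : ℝ) : Prop := S v z ∧ |z| ≤ sInf {r | ∃ z, S v z ∧ |z| = r} + 1
  have hT : DefFamily L T := by
    have hAbs : DefFun L fun v : α → ℝ => sInf {r | ∃ z, S v z ∧ |z| = r} :=
      .sInf (.exists_real (.and (hS.family (fun _ => .coord _) (.coord _))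
        ((DefFun.coord _).abs.eq (.coord _))))
    exact hS.and ((DefFun.coord _).abs.le ((hAbs.comp fun _ => .coord _).add (.const 1)))
  refine ⟨_, .selectPoint hT, fun v hne => ?_⟩
  have hTne : ∃ z, T v z := by
    obtain ⟨r, ⟨z, hz, rfl⟩, hr⟩ := Real.lt_sInf_add_pos
      (s := {r | ∃ z, S v z ∧ |z| = r}) (hne.imp' abs fun z hz => ⟨z, hz, rfl⟩) one_pos
    exact ⟨z, hz, hr.le⟩
  exact (hL.selectPoint_mem (P := T v) (hT.family (f := fun _ => v) (fun _ => .const _) (.coord 0))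
    hTne ⟨_, fun z hz => (abs_le.1 hz.2).1⟩ ⟨_, fun z hz => (abs_le.1 hz.2).2⟩).1

theorem IsOMinimal.exists_definable_choice (hL : IsOMinimal L) [Finite β]
    {S : (α → ℝ) → (β → ℝ) → Prop} (hS : DefRel L S) :
    ∃ g : (α → ℝ) → β → ℝ, (∀ b, DefFun L fun v => g v b) ∧ ∀ v, (∃ z, S v z) → S v (g v) := by
  revert S
  induction β using Finite.induction_empty_option with
  | of_equiv e ih =>
    intro S hS
    obtain ⟨g, hg, hgS⟩ := ih (S := fun v z => S v (z ∘ e.symm))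
      (Set.Definable.preimage_comp (Sum.map id e.symm) hS)
    refine ⟨fun v => g v ∘ e.symm, fun b => hg _, fun v ⟨z, hz⟩ => hgS v ⟨z ∘ e, ?_⟩⟩
    rwa [Function.comp_assoc, e.self_comp_symm]
  | h_empty =>
    intro S _
    refine ⟨fun _ => PEmpty.elim, fun b => b.elim, fun v ⟨z, hz⟩ => ?_⟩
    rwa [Subsingleton.elim PEmpty.elim z]
  | h_option ih =>
    intro S hS
    obtain ⟨g, hg, hgS⟩ := ih (S := fun v z => ∃ x, S v fun o => o.elim x z) (.exists_real
      (.rel hS (fun _ => .coord _) (Option.rec (.coord _) fun _ => .coord _)))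
    obtain ⟨k, hk, hkS⟩ := hL.exists_definable_choice_real
      (S := fun v x => S v fun o => o.elim x (g v))
      (.rel hS (fun _ => .coord _) (Option.rec (.coord _) fun b => (hg b).comp fun _ => .coord _))
    refine ⟨fun v o => o.elim (k v) (g v), Option.rec hk hg, fun v ⟨z, hz⟩ => hkS v (hgS v ?_)⟩
    refine ⟨fun b => z (some b), z none, ?_⟩
    convert hz with o
    cases o <;> rfl

theorem IsOMinimal.exists_definable_selection (hL : IsOMinimal L) {P : (α → ℝ) → Prop}
    (hP : DefPred L P) {f : (α → ℝ) → ℝ} (hf : DefFun L f)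
    (h : ∃ᶠ t in 𝓝[>] 0, ∃ w, f w = t ∧ P w) :
    ∃ γ : ℝ → α → ℝ, (∀ a, DefFun₁ L fun t => γ t a) ∧
      ∀ᶠ t in 𝓝[>] 0, f (γ t) = t ∧ P (γ t) := by
  have hS : DefRel L fun (v : Fin 1 → ℝ) w => f w = v 0 ∧ P w :=
    .and ((hf.comp fun _ => .coord _).eq (.coord _)) (hP.comp fun _ => .coord _)
  obtain ⟨g, hg, hgS⟩ := hL.exists_definable_choice hS
  refine ⟨fun t => g fun _ => t, fun a => (hg a).comp fun _ => .coord 0, ?_⟩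
  filter_upwards [(hL.eventually_nhdsGT_or_not (P := fun t => ∃ w, f w = t ∧ P w)
    (.exists_tuple hS) 0).resolve_right h] with t ht
  exact hgS (fun _ => t) ht

end Choice

/-! ### The monotonicity theorem for germs of definable functions -/

section Monotonicity

theorem countable_image_isLocalMin {X Y : Type*} [TopologicalSpace X] [SecondCountableTopology X]
    [PartialOrder Y] (f : X → Y) : (f '' {x | IsLocalMin f x}).Countable := by
  have hsub : f '' {x | IsLocalMin f x} ⊆
      ⋃ U ∈ TopologicalSpace.countableBasis X, {y | IsLeast (f '' U) y} := by
    rintro _ ⟨x, hx, rfl⟩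
    obtain ⟨U, hU, hxU, hmin⟩ :=
      (TopologicalSpace.isBasis_countableBasis X).mem_nhds_iff.1 (show _ ∈ 𝓝 x from hx)
    exact mem_biUnion hU ⟨mem_image_of_mem f hxU, forall_mem_image.2 hmin⟩
  exact ((TopologicalSpace.countable_countableBasis X).biUnion fun U _ =>
    Subsingleton.countable (s := {y | IsLeast (f '' U) y}) fun _ ha _ hb => ha.unique hb).mono hsub

theorem monotoneOn_Ioo_of_local {F : ℝ → ℝ} {a b : ℝ}
    (hr : ∀ t ∈ Ioo a b, ∀ᶠ s in 𝓝[>] t, F t ≤ F s)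
    (hl : ∀ t ∈ Ioo a b, ∀ᶠ s in 𝓝[<] t, F s ≤ F t) : MonotoneOn F (Ioo a b) := by
  intro x hx y hy hxy
  let A : Set ℝ := {s ∈ Icc x y | ∀ r ∈ Icc x s, F x ≤ F r}
  have hxA : x ∈ A := ⟨left_mem_Icc.2 hxy, fun r hr => (le_antisymm hr.1 hr.2) ▸ le_rfl⟩
  have hAb : BddAbove A := ⟨y, fun s hs => hs.1.2⟩
  let c := sSup A
  have hxc : x ≤ c := le_csSup hAb hxA
  have hcy : c ≤ y := csSup_le ⟨x, hxA⟩ fun s hs => hs.1.2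
  have hc : c ∈ Ioo a b := ⟨hx.1.trans_le hxc, hcy.trans_lt hy.2⟩
  have hlt : ∀ r, x ≤ r → r < c → F x ≤ F r := fun r hxr hrc => by
    obtain ⟨s, hs, hrs⟩ := exists_lt_of_lt_csSup ⟨x, hxA⟩ hrc
    exact hs.2 r ⟨hxr, hrs.le⟩
  have hle : ∀ r, x ≤ r → r ≤ c → F x ≤ F r := fun r hxr hrc => by
    rcases hrc.lt_or_eq with hrc | rfl
    · exact hlt r hxr hrc
    rcases hxr.eq_or_lt with h | h
    · rw [← h]
    · obtain ⟨s, hs, hsI⟩ := ((hl c hc).and (Ioo_mem_nhdsLT h)).exists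
      exact (hlt s hsI.1.le hsI.2).trans hs
  refine hle y hxy (le_of_not_gt fun h => ?_)
  obtain ⟨d, hd, hdF⟩ := mem_nhdsGT_iff_exists_Ioo_subset.1 ((hr c hc).and (Ioo_mem_nhdsGT h))
  obtain ⟨e, hce, hed⟩ := exists_between (mem_Ioi.1 hd)
  refine hce.not_ge (le_csSup hAb ⟨⟨hxc.trans hce.le, (hdF ⟨hce, hed⟩).2.2.le⟩, fun r hr => ?_⟩)
  rcases le_or_gt r c with hrc | hrc
  · exact hle r hr.1 hrc
  · exact (hle c hxc le_rfl).trans (hdF ⟨hrc, hr.2.trans_lt hed⟩).1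

theorem exists_monotoneOn_Ioo_of_eventually_local {F : ℝ → ℝ} {a : ℝ}
    (hr : ∀ᶠ t in 𝓝[>] a, ∀ᶠ s in 𝓝[>] t, F t ≤ F s)
    (hl : ∀ᶠ t in 𝓝[>] a, ∀ᶠ s in 𝓝[<] t, F s ≤ F t) : ∃ b > a, MonotoneOn F (Ioo a b) := by
  obtain ⟨b, hb, h⟩ := mem_nhdsGT_iff_exists_Ioo_subset.1 (hr.and hl)
  exact ⟨b, hb, monotoneOn_Ioo_of_local (fun t ht => (h ht).1) fun t ht => (h ht).2⟩

variable {L : FirstOrder.Language.{u, v}} [L.Structure ℝ]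

theorem DefPred.eventually_nhdsGT [ExpandsRealField L] {α : Type*} [Finite α]
    {S : (α → ℝ) → ℝ → Prop} (hS : DefFamily L S) {f : (α → ℝ) → ℝ} (hf : DefFun L f) :
    DefPred L fun v => ∀ᶠ s in 𝓝[>] f v, S v s := by
  refine DefPred.congr (P := fun v => ∃ r, f v < r ∧ ∀ s, f v < s → s < r → S v s)
    (.exists_real (.and ((hf.comp fun _ => .coord _).lt (.coord _)) (.forall_real
      (.imp ((hf.comp fun _ => .coord _).lt (.coord _)) (.imp ?_ ?_))))) fun v => ?_
  · exact (DefFun.coord _).lt (.coord _)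
  · exact hS.family (fun _ => .coord _) (.coord _)
  · refine Iff.trans ?_ mem_nhdsGT_iff_exists_Ioo_subset.symm
    exact exists_congr fun r => and_congr_right fun _ =>
      ⟨fun h s hs => h s hs.1 hs.2, fun h s h₁ h₂ => h ⟨h₁, h₂⟩⟩

theorem DefPred.eventually_nhdsLT [ExpandsRealField L] {α : Type*} [Finite α]
    {S : (α → ℝ) → ℝ → Prop} (hS : DefFamily L S) {f : (α → ℝ) → ℝ} (hf : DefFun L f) :
    DefPred L fun v => ∀ᶠ s in 𝓝[<] f v, S v s := by
  refine (eventually_nhdsGT (S := fun v s => S v (-s)) (hS.family (fun _ => .coord _)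
    (DefFun.coord _).neg) hf.neg).congr fun v => ⟨fun h => ?_, fun h => ?_⟩
  · simpa only [neg_neg] using tendsto_neg_nhdsLT.eventually h
  · exact tendsto_neg_nhdsGT_neg.eventually h

namespace IsOMinimal

theorem countable_of_interior_eq_empty (hL : IsOMinimal L) {P : ℝ → Prop} (hP : DefPred₁ L P)
    (h : interior {t | P t} = ∅) : {t | P t}.Countable := by
  obtain ⟨G, hG, hI, hPG⟩ := hL.finite_union_intervals {t | P t} hP
  rw [hPG]
  refine hG.countable.sUnion fun I hIG =>
    Subsingleton.countable (not_nontrivial_iff.1 fun hne => ?_)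
  refine ((hI I hIG).convex.nontrivial_iff_nonempty_interior.1 hne).ne_empty ?_
  exact subset_empty_iff.1 (h ▸ interior_mono (hPG ▸ subset_sUnion_of_mem hIG))

theorem exists_eventually_eq_of_isLocalMin (hL : IsOMinimal L) {F : ℝ → ℝ} (hF : DefFun₁ L F)
    {a b : ℝ} (hab : a < b) (hmin : ∀ t ∈ Ioo a b, IsLocalMin F t) :
    ∃ t ∈ Ioo a b, ∀ᶠ s in 𝓝 t, F s = F t := by
  have := hL.expandsRealField
  by_contra hnot
  have hlevel : ∀ c, {t | a < t ∧ t < b ∧ F t = c}.Countable := fun c => by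
    refine hL.countable_of_interior_eq_empty (P := fun t => a < t ∧ t < b ∧ F t = c)
      (.and ((DefFun.const a).lt (.coord 0)) (.and ((DefFun.coord 0).lt (.const b))
        (hF.eq (.const c)))) (eq_empty_of_forall_notMem fun t ht => ?_)
    obtain ⟨hat, htb, htc⟩ := interior_subset ht
    refine hnot ⟨t, ⟨hat, htb⟩, ?_⟩
    filter_upwards [isOpen_interior.mem_nhds ht] with s hs
    exact (interior_subset hs).2.2.trans htc.symm
  have hvalues : (F '' Ioo a b).Countable :=
    (countable_image_isLocalMin F).mono (image_mono hmin)
  have hIoo : (Ioo a b).Countable := (hvalues.biUnion fun c _ => hlevel c).mono fun t ht =>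
    mem_biUnion (mem_image_of_mem F ht) (show _ ∧ _ ∧ _ from ⟨ht.1, ht.2, rfl⟩)
  exact (Cardinal.Real.Ioo_countable_iff.1 hIoo).not_gt hab

variable {F : ℝ → ℝ}

theorem exists_monotoneOn_of_eventually_isLocalMin (hL : IsOMinimal L) (hF : DefFun₁ L F) {a : ℝ}
    (hr : ∀ᶠ t in 𝓝[>] a, ∀ᶠ s in 𝓝[>] t, F t ≤ F s)
    (hl : ∀ᶠ t in 𝓝[>] a, ∀ᶠ s in 𝓝[<] t, F t ≤ F s) : ∃ b > a, MonotoneOn F (Ioo a b) := by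
  have := hL.expandsRealField
  have hEq : DefFamily L fun (v : Fin 1 → ℝ) s => F s = F (v 0) :=
    (hF.comp₁ (.coord _)).eq (hF.comp₁ (.coord _))
  have hConst : DefPred₁ L fun t => (∀ᶠ s in 𝓝[>] t, F s = F t) ∧ ∀ᶠ s in 𝓝[<] t, F s = F t :=
    (DefPred.eventually_nhdsGT hEq (.coord 0)).and (DefPred.eventually_nhdsLT hEq (.coord 0))
  rcases hL.eventually_nhdsGT_or_not hConst a with h | h
  · exact exists_monotoneOn_Ioo_of_eventually_local
      (h.mono fun t ht => ht.1.mono fun s hs => hs.ge)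
      (h.mono fun t ht => ht.2.mono fun s hs => hs.le)
  obtain ⟨b, hb, hsub⟩ := mem_nhdsGT_iff_exists_Ioo_subset.1 ((hr.and hl).and h)
  obtain ⟨t, ht, hconst⟩ := hL.exists_eventually_eq_of_isLocalMin hF hb fun t ht => by
    rw [IsLocalMin, IsMinFilter, ← nhdsNE_sup_pure, ← nhdsLT_sup_nhdsGT, eventually_sup,
      eventually_sup, eventually_pure]
    exact ⟨⟨(hsub ht).1.2, (hsub ht).1.1⟩, le_rfl⟩
  exact ((hsub ht).2 ⟨hconst.filter_mono nhdsWithin_le_nhds,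
    hconst.filter_mono nhdsWithin_le_nhds⟩).elim

theorem exists_monotoneOn_or_antitoneOn (hL : IsOMinimal L) (hF : DefFun₁ L F) (a : ℝ) :
    ∃ b > a, MonotoneOn F (Ioo a b) ∨ AntitoneOn F (Ioo a b) := by
  have := hL.expandsRealField
  have hle : DefFamily L fun (v : Fin 1 → ℝ) s => F (v 0) ≤ F s :=
    (hF.comp₁ (.coord _)).le (hF.comp₁ (.coord _))
  have hle₁ : ∀ t, DefPred₁ L fun s => F t ≤ F s := fun t => (DefFun.const _).le hF
  have hright : (∀ᶠ t in 𝓝[>] a, ∀ᶠ s in 𝓝[>] t, F t ≤ F s) ∨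
      ∀ᶠ t in 𝓝[>] a, ∀ᶠ s in 𝓝[>] t, F s ≤ F t := by
    refine (hL.eventually_nhdsGT_or_not (DefPred.eventually_nhdsGT hle (.coord 0)) a).imp_right
      fun h => h.mono fun t ht => ?_
    exact ((hL.eventually_nhdsGT_or_not (hle₁ t) t).resolve_left ht).mono fun s => le_of_not_ge
  have hleft : (∀ᶠ t in 𝓝[>] a, ∀ᶠ s in 𝓝[<] t, F t ≤ F s) ∨
      ∀ᶠ t in 𝓝[>] a, ∀ᶠ s in 𝓝[<] t, F s ≤ F t := by
    refine (hL.eventually_nhdsGT_or_not (DefPred.eventually_nhdsLT hle (.coord 0)) a).imp_right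
      fun h => h.mono fun t ht => ?_
    exact ((hL.eventually_nhdsLT_or_not (hle₁ t) t).resolve_left ht).mono fun s => le_of_not_ge
  have hanti : ∀ {b}, MonotoneOn (fun t => -F t) (Ioo a b) → AntitoneOn F (Ioo a b) :=
    fun h x hx y hy hxy => neg_le_neg_iff.1 (h hx hy hxy)
  rcases hright with hr | hr <;> rcases hleft with hl | hl
  · exact (hL.exists_monotoneOn_of_eventually_isLocalMin hF hr hl).imp fun _ => .imp_right .inl
  · exact (exists_monotoneOn_Ioo_of_eventually_local hr hl).imp fun _ => .imp_right .inl
  · refine (exists_monotoneOn_Ioo_of_eventually_local (F := fun t => -F t) ?_ ?_).imp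
      fun _ => .imp_right fun h => .inr (hanti h) <;> simpa only [neg_le_neg_iff]
  · refine (hL.exists_monotoneOn_of_eventually_isLocalMin hF.neg ?_ ?_).imp
      fun _ => .imp_right fun h => .inr (hanti h) <;> simpa only [neg_le_neg_iff]

end IsOMinimal

end Monotonicity

/-! ### Limits and derivatives of definable germs -/

section Germs

open MeasureTheory

variable {L : FirstOrder.Language.{u, v}} [L.Structure ℝ] {n : ℕ} {F G : ℝ → ℝ} {q r : ℝ → E n}

theorem tendsto_const_mul_nhdsGT_zero (c : ℝ) : Tendsto (fun t => c * t) (𝓝[>] 0) (𝓝 0) := by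
  simpa using (tendsto_id'.2 (nhdsWithin_le_nhds (a := (0 : ℝ)) (s := Ioi 0))).const_mul c

namespace IsOMinimal

theorem exists_tendsto (hL : IsOMinimal L) (hF : DefFun₁ L F) {a C : ℝ}
    (hC : ∀ᶠ t in 𝓝[>] a, |F t| ≤ C) : ∃ l, Tendsto F (𝓝[>] a) (𝓝 l) := by
  obtain ⟨b, hab, hmono⟩ := hL.exists_monotoneOn_or_antitoneOn hF a
  obtain ⟨c, hac, hsub⟩ := mem_nhdsGT_iff_exists_Ioo_subset.1 (hC.and (Ioo_mem_nhdsGT hab))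
  have hIoo : Ioo a c ⊆ Ioo a b := fun t ht => (hsub ht).2
  have hne : (Ioo a c).Nonempty := nonempty_Ioo.2 hac
  rcases hmono with h | h
  · exact ⟨_, (h.mono hIoo).tendsto_nhdsWithin_Ioo_right hne
      ⟨-C, forall_mem_image.2 fun t ht => (abs_le.1 (hsub ht).1).1⟩⟩
  · exact ⟨_, (h.mono hIoo).tendsto_nhdsWithin_Ioo_right hne
      ⟨C, forall_mem_image.2 fun t ht => (abs_le.1 (hsub ht).1).2⟩⟩

theorem exists_tendsto_curve (hL : IsOMinimal L) (hq : DefCurve L q) {a C : ℝ}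
    (hC : ∀ᶠ t in 𝓝[>] a, ‖q t‖ ≤ C) : ∃ l, Tendsto q (𝓝[>] a) (𝓝 l) := by
  have hcoord : ∀ i, ∃ l, Tendsto (fun t => q t i) (𝓝[>] a) (𝓝 l) := fun i =>
    hL.exists_tendsto (hq i) (hC.mono fun t ht => (PiLp.norm_apply_le (q t) i).trans ht)
  choose l hl using hcoord
  exact ⟨WithLp.toLp 2 l,
    ((PiLp.continuous_toLp 2 _).tendsto l).comp (tendsto_pi_nhds.2 hl)⟩

theorem eventually_ae_differentiableAt (hL : IsOMinimal L) (hF : DefFun₁ L F) (a : ℝ) :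
    ∀ᶠ b in 𝓝[>] a, ∀ᵐ t ∂volume.restrict (Ioo a b), DifferentiableAt ℝ F t := by
  obtain ⟨c, hac, hmono⟩ := hL.exists_monotoneOn_or_antitoneOn hF a
  have hae : ∀ᵐ t, t ∈ Ioo a c → DifferentiableWithinAt ℝ F (Ioo a c) t := by
    rcases hmono with h | h
    · exact h.ae_differentiableWithinAt_of_mem
    · exact h.neg.ae_differentiableWithinAt_of_mem.mono fun t ht hmem =>
        differentiableWithinAt_fun_neg_iff.1 (ht hmem)
  filter_upwards [Ioo_mem_nhdsGT hac] with b hb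
  refine (ae_restrict_iff' measurableSet_Ioo).2 (hae.mono fun t ht hmem => ?_)
  have htc : t ∈ Ioo a c := ⟨hmem.1, hmem.2.trans hb.2⟩
  exact (ht htc).differentiableAt (Ioo_mem_nhds htc.1 htc.2)

theorem eventually_ae_differentiableAt_curve (hL : IsOMinimal L) (hq : DefCurve L q) (a : ℝ) :
    ∀ᶠ b in 𝓝[>] a, ∀ᵐ t ∂volume.restrict (Ioo a b), DifferentiableAt ℝ q t := by
  have hcoord := eventually_all.2 fun i =>
    hL.eventually_ae_differentiableAt (F := fun t => q t i) (hq i) a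
  filter_upwards [hcoord] with b hb
  exact (ae_all_iff.2 hb).mono fun t ht => differentiableAt_euclidean.2 ht

theorem frequently_differentiableAt (hL : IsOMinimal L) (hq : DefCurve L q) (hr : DefCurve L r)
    (a : ℝ) : ∃ᶠ t in 𝓝[>] a, DifferentiableAt ℝ q t ∧ DifferentiableAt ℝ r t := by
  refine frequently_iff.2 fun {U} hU => ?_
  obtain ⟨c, hac, hsub⟩ := mem_nhdsGT_iff_exists_Ioo_subset.1 hU
  obtain ⟨b, ⟨hqb, hrb⟩, hb⟩ := ((hL.eventually_ae_differentiableAt_curve hq a).and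
    (hL.eventually_ae_differentiableAt_curve hr a) |>.and (Ioo_mem_nhdsGT hac)).exists
  have : (ae (volume.restrict (Ioo a b))).NeBot :=
    ae_restrict_neBot.2 (Measure.measure_Ioo_pos _ |>.2 hb.1).ne'
  obtain ⟨t, ht, hdiff⟩ := ((ae_restrict_mem measurableSet_Ioo).and (hqb.and hrb)).exists
  exact ⟨t, hsub ⟨ht.1, ht.2.trans hb.2⟩, hdiff⟩

theorem eventually_deriv_nonpos (hL : IsOMinimal L) (hF : DefFun₁ L F) {a : ℝ}
    (h0 : Tendsto F (𝓝[>] a) (𝓝 0)) (hneg : ∀ᶠ t in 𝓝[>] a, F t ≤ 0) :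
    ∀ᶠ t in 𝓝[>] a, ∀ F', HasDerivAt F F' t → F' ≤ 0 := by
  have hanti : ∃ b > a, AntitoneOn F (Ioo a b) := by
    obtain ⟨b, hb, h | h⟩ := hL.exists_monotoneOn_or_antitoneOn hF a
    · obtain ⟨c, hc, hsub⟩ := mem_nhdsGT_iff_exists_Ioo_subset.1 (hneg.and (Ioo_mem_nhdsGT hb))
      have hzero : ∀ t ∈ Ioo a c, F t = 0 := fun t ht => by
        refine le_antisymm (hsub ht).1 (le_of_tendsto h0 ?_)
        filter_upwards [Ioo_mem_nhdsGT ht.1] with s hs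
        exact h (hsub ⟨hs.1, hs.2.trans ht.2⟩).2 (hsub ht).2 hs.2.le
      exact ⟨c, hc, fun x hx y hy _ => by rw [hzero x hx, hzero y hy]⟩
    · exact ⟨b, hb, h⟩
  obtain ⟨b, hb, h⟩ := hanti
  filter_upwards [Ioo_mem_nhdsGT hb] with t ht F' hF'
  have hderiv : derivWithin F (Ioo a b) t ≤ 0 := h.derivWithin_nonpos
  rwa [derivWithin_of_mem_nhds (Ioo_mem_nhds ht.1 ht.2), hF'.deriv] at hderiv

theorem eventually_abs_deriv_le (hL : IsOMinimal L) (hF : DefFun₁ L F) (hG : DefFun₁ L G)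
    {a C : ℝ} (hG0 : Tendsto G (𝓝[>] a) (𝓝 0)) (hle : ∀ᶠ t in 𝓝[>] a, |F t| ≤ C * G t) :
    ∀ᶠ t in 𝓝[>] a, ∀ F' G', HasDerivAt F F' t → HasDerivAt G G' t → |F'| ≤ C * G' := by
  have := hL.expandsRealField
  have hCG : Tendsto (fun t => C * G t) (𝓝[>] a) (𝓝 0) := by
    simpa only [mul_zero] using hG0.const_mul C
  have hF0 : Tendsto F (𝓝[>] a) (𝓝 0) := squeeze_zero_norm' hle hCG
  have hupper : ∀ᶠ t in 𝓝[>] a, ∀ D, HasDerivAt (fun t => F t - C * G t) D t → D ≤ 0 :=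
    hL.eventually_deriv_nonpos (hF.sub (.mul (.const C) hG)) (by simpa using hF0.sub hCG)
      (hle.mono fun t ht => sub_nonpos.2 (le_of_abs_le ht))
  have hlower : ∀ᶠ t in 𝓝[>] a, ∀ D, HasDerivAt (fun t => -F t - C * G t) D t → D ≤ 0 :=
    hL.eventually_deriv_nonpos (hF.neg.sub (.mul (.const C) hG)) (by simpa using hF0.neg.sub hCG)
      (hle.mono fun t ht => sub_nonpos.2 ((neg_le_abs _).trans ht))
  filter_upwards [hupper, hlower] with t hup hlow F' G' hF' hG'
  exact abs_le'.2 ⟨sub_nonpos.1 (hup _ (hF'.sub (hG'.const_mul C))),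
    sub_nonpos.1 (hlow _ (hF'.neg.sub (hG'.const_mul C)))⟩

end IsOMinimal

theorem norm_le_card_mul {v : E n} {C : ℝ} (h : ∀ i, |v i| ≤ C) : ‖v‖ ≤ n * C := by
  calc ‖v‖ = ‖∑ i, v i • EuclideanSpace.basisFun (Fin n) ℝ i‖ := by
        congr 1
        exact ((EuclideanSpace.basisFun (Fin n) ℝ).sum_repr v).symm
    _ ≤ ∑ i, ‖v i • EuclideanSpace.basisFun (Fin n) ℝ i‖ := norm_sum_le _ _
    _ ≤ ∑ _i : Fin n, C := Finset.sum_le_sum fun i _ => by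
        rw [norm_smul, OrthonormalBasis.norm_eq_one, mul_one]
        exact h i
    _ = n * C := by rw [Finset.sum_const, Finset.card_fin, nsmul_eq_mul]

namespace IsOMinimal

theorem eventually_norm_deriv_le (hL : IsOMinimal L) (hq : DefCurve L q) (hG : DefFun₁ L G)
    {a C : ℝ} (hG0 : Tendsto G (𝓝[>] a) (𝓝 0)) (hle : ∀ᶠ t in 𝓝[>] a, ‖q t‖ ≤ C * G t) :
    ∀ᶠ t in 𝓝[>] a, ∀ q' G', HasDerivAt q q' t → HasDerivAt G G' t → ‖q'‖ ≤ n * (C * G') := by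
  have hcoord := eventually_all.2 fun i =>
    hL.eventually_abs_deriv_le (F := fun t => q t i) (hq i) hG hG0
      (hle.mono fun t ht => (PiLp.norm_apply_le (q t) i).trans ht)
  filter_upwards [hcoord] with t ht q' G' hq' hG'
  exact norm_le_card_mul fun i => ht i _ _
    ((EuclideanSpace.proj i : E n →L[ℝ] ℝ).hasFDerivAt.comp_hasDerivAt t hq') hG'

theorem eventually_le_two_mul_deriv (hL : IsOMinimal L) (hF : DefFun₁ L F) {C : ℝ}
    (hpos : ∀ᶠ t in 𝓝[>] 0, 0 < F t) (hle : ∀ᶠ t in 𝓝[>] 0, F t ≤ C * t) :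
    ∀ᶠ t in 𝓝[>] 0, ∀ F', HasDerivAt F F' t → F t ≤ 2 * (t * F') := by
  have := hL.expandsRealField
  have ht0 : ∀ᶠ t in 𝓝[>] (0 : ℝ), 0 < t := self_mem_nhdsWithin
  have hbound : ∀ᶠ t in 𝓝[>] (0 : ℝ), ‖-(F t * F t * t⁻¹)‖ ≤ C ^ 2 * t := by
    filter_upwards [hpos, hle, ht0] with t h0 h1 ht
    rw [norm_neg, Real.norm_of_nonneg (by positivity), ← div_eq_mul_inv, div_le_iff₀ ht]
    nlinarith
  have hlim : Tendsto (fun t => -(F t * F t * t⁻¹)) (𝓝[>] 0) (𝓝 0) :=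
    squeeze_zero_norm' hbound (tendsto_const_mul_nhdsGT_zero _)
  -- `F² / t` tends to `0` and is positive, hence increasing.
  have hderiv := hL.eventually_deriv_nonpos (hF.mul hF |>.mul (DefFun.coord 0).inv).neg hlim
    ((hpos.and ht0).mono fun t ⟨h0, ht⟩ => neg_nonpos.2 (by positivity))
  filter_upwards [hderiv, hpos, ht0] with t hd h0 ht F' hF'
  have hd := hd _ ((hF'.fun_mul hF').fun_mul (hasDerivAt_inv ht.ne')).neg
  have hfactor : -((F' * F t + F t * F') * t⁻¹ + F t * F t * -(t ^ 2)⁻¹) =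
      F t / t ^ 2 * (F t - 2 * (t * F')) := by
    field_simp
    ring
  rw [hfactor] at hd
  exact sub_nonpos.1 (nonpos_of_mul_nonpos_right hd (by positivity))

end IsOMinimal

end Germs

/-! ### Growth of definable secants -/

section Slope

variable {L : FirstOrder.Language.{u, v}} [L.Structure ℝ] {n : ℕ} {q m : ℝ → E n} {C ε : ℝ}

namespace IsOMinimal

theorem eventually_deriv_mem_cone (hL : IsOMinimal L) (hq : DefCurve L q) {m₀ : E n} (hε : 0 < ε)
    (hne : ∀ᶠ t in 𝓝[>] 0, q t ≠ 0) (hlin : ∀ᶠ t in 𝓝[>] 0, ‖q t‖ ≤ C * t)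
    (hang : ∀ᶠ t in 𝓝[>] 0, ε * ‖q t‖ ≤ inner ℝ (q t) m₀) :
    ∀ᶠ t in 𝓝[>] 0, ∀ q', HasDerivAt q q' t →
      ε * ‖q t‖ ≤ 2 * (t * inner ℝ q' m₀) ∧ ‖q'‖ ≤ n * (ε⁻¹ * inner ℝ q' m₀) := by
  have := hL.expandsRealField
  let H (t : ℝ) : ℝ := inner ℝ (q t) m₀
  have hH : DefFun₁ L H := hq.inner (.const m₀)
  have hHpos : ∀ᶠ t in 𝓝[>] 0, 0 < H t := (hne.and hang).mono fun t ⟨h0, h⟩ =>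
    (mul_pos hε (norm_pos_iff.2 h0)).trans_le h
  have hHle : ∀ᶠ t in 𝓝[>] 0, H t ≤ C * ‖m₀‖ * t := hlin.mono fun t ht =>
    calc H t ≤ ‖q t‖ * ‖m₀‖ := real_inner_le_norm _ _
      _ ≤ C * t * ‖m₀‖ := by gcongr
      _ = C * ‖m₀‖ * t := by ring
  have hH0 : Tendsto H (𝓝[>] 0) (𝓝 0) :=
    squeeze_zero' (hHpos.mono fun t => le_of_lt) hHle (tendsto_const_mul_nhdsGT_zero _)
  have hqH : ∀ᶠ t in 𝓝[>] 0, ‖q t‖ ≤ ε⁻¹ * H t := hang.mono fun t ht =>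
    (le_inv_mul_iff₀ hε).2 ht
  filter_upwards [hL.eventually_le_two_mul_deriv hH hHpos hHle,
    hL.eventually_norm_deriv_le hq hH hH0 hqH, hang] with t hslope hnorm ht q' hq'
  have hH' : HasDerivAt H (inner ℝ q' m₀) t := by
    simpa using hq'.inner ℝ (hasDerivAt_const t m₀)
  exact ⟨ht.trans (hslope _ hH'), hnorm _ _ hq' hH'⟩

theorem eventually_norm_le_mul_inner_deriv (hL : IsOMinimal L) (hq : DefCurve L q)
    (hm : DefCurve L m) (hε : 0 < ε) (hne : ∀ᶠ t in 𝓝[>] 0, q t ≠ 0)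
    (hlin : ∀ᶠ t in 𝓝[>] 0, ‖q t‖ ≤ C * t) (hunit : ∀ᶠ t in 𝓝[>] 0, ‖m t‖ = 1)
    (hang : ∀ᶠ t in 𝓝[>] 0, ε * ‖q t‖ ≤ inner ℝ (q t) (m t)) :
    ∀ᶠ t in 𝓝[>] 0, ∀ q', HasDerivAt q q' t → ε / 8 * ‖q t‖ ≤ t * inner ℝ q' (m t) := by
  obtain ⟨m₀, hm₀⟩ := hL.exists_tendsto_curve hm (hunit.mono fun t => le_of_eq)
  have hdist : Tendsto (fun t => ‖m t - m₀‖) (𝓝[>] 0) (𝓝 0) :=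
    tendsto_iff_norm_sub_tendsto_zero.1 hm₀
  have hinner : ∀ v t, |inner ℝ v (m t) - inner ℝ v m₀| ≤ ‖v‖ * ‖m t - m₀‖ := fun v t => by
    rw [← inner_sub_right]
    exact abs_real_inner_le_norm _ _
  have hang₀ : ∀ᶠ t in 𝓝[>] 0, ε / 2 * ‖q t‖ ≤ inner ℝ (q t) m₀ := by
    filter_upwards [hang, hdist.eventually_le_const (half_pos hε)] with t ht hclose
    have := mul_le_mul_of_nonneg_left hclose (norm_nonneg (q t))
    linarith [(abs_le.1 (hinner (q t) t)).2]
  have hsmall : ∀ᶠ t in 𝓝[>] 0, n * (ε / 2)⁻¹ * ‖m t - m₀‖ ≤ 1 / 2 :=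
    (hdist.const_mul (n * (ε / 2)⁻¹)).eventually_le_const (by norm_num)
  filter_upwards [hL.eventually_deriv_mem_cone hq (half_pos hε) hne hlin hang₀, hsmall,
    self_mem_nhdsWithin] with t hcone hsmall ht q' hq'
  obtain ⟨hslope, hnorm⟩ := hcone q' hq'
  have hslope₀ : 0 ≤ inner ℝ q' m₀ := by
    have : 0 ≤ 2 * (t * inner ℝ q' m₀) := le_trans (by positivity) hslope
    exact nonneg_of_mul_nonneg_right (nonneg_of_mul_nonneg_right this two_pos) ht
  have hhalf : inner ℝ q' m₀ / 2 ≤ inner ℝ q' (m t) := by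
    have : ‖q'‖ * ‖m t - m₀‖ ≤ inner ℝ q' m₀ / 2 := calc
      ‖q'‖ * ‖m t - m₀‖ ≤ n * ((ε / 2)⁻¹ * inner ℝ q' m₀) * ‖m t - m₀‖ := by gcongr
      _ = n * (ε / 2)⁻¹ * ‖m t - m₀‖ * inner ℝ q' m₀ := by ring
      _ ≤ 1 / 2 * inner ℝ q' m₀ := by gcongr
      _ = inner ℝ q' m₀ / 2 := by ring
    linarith [(abs_le.1 (hinner q' t)).1]
  linarith [mul_le_mul_of_nonneg_left hhalf (le_of_lt ht)]

end IsOMinimal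

end Slope

/-! ### Angles and tangent spaces -/

section Geometry

variable {n : ℕ}

section Angles

variable {A A' B : Submodule ℝ (E n)} {v m : E n}

theorem inner_le_norm_of_norm_eq_one (v : E n) (hm : ‖m‖ = 1) : inner ℝ v m ≤ ‖v‖ := by
  simpa only [hm, mul_one] using real_inner_le_norm v m

theorem inner_le_eta (hm : m ∈ Bᗮ) (h1 : ‖m‖ = 1) : inner ℝ v m ≤ eta v B := by
  refine le_csSup ⟨‖v‖, ?_⟩ ⟨m, hm, h1, rfl⟩
  rintro _ ⟨m', -, h1', rfl⟩
  exact inner_le_norm_of_norm_eq_one v h1'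

theorem eta_le {r : ℝ} (hr : 0 ≤ r) (h : ∀ m ∈ Bᗮ, ‖m‖ = 1 → inner ℝ v m ≤ r) : eta v B ≤ r := by
  refine Real.sSup_le ?_ hr
  rintro _ ⟨m, hm, h1, rfl⟩
  exact h m hm h1

theorem eta_le_norm (v : E n) (B : Submodule ℝ (E n)) : eta v B ≤ ‖v‖ :=
  eta_le (norm_nonneg v) fun _ _ => inner_le_norm_of_norm_eq_one v

theorem exists_normal_of_lt_eta {r : ℝ} (hr : 0 ≤ r) (h : r < eta v B) :
    ∃ m ∈ Bᗮ, ‖m‖ = 1 ∧ r < inner ℝ v m := by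
  contrapose! h
  exact eta_le hr h

theorem eta_nonneg (v : E n) (B : Submodule ℝ (E n)) : 0 ≤ eta v B := by
  by_cases h : ∃ m ∈ Bᗮ, ‖m‖ = 1
  · obtain ⟨m, hm, h1⟩ := h
    have hpos := inner_le_eta (v := v) hm h1
    have hneg := inner_le_eta (v := v) (neg_mem hm) (by rwa [norm_neg])
    rw [inner_neg_right] at hneg
    linarith
  · refine Real.sSup_nonneg ?_
    rintro _ ⟨m, hm, h1, -⟩
    exact absurd ⟨m, hm, h1⟩ h

theorem subspaceDist_nonneg (A B : Submodule ℝ (E n)) : 0 ≤ subspaceDist A B := by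
  refine Real.sSup_nonneg ?_
  rintro _ ⟨v, -, -, rfl⟩
  exact eta_nonneg v B

theorem subspaceDist_le_one (A B : Submodule ℝ (E n)) : subspaceDist A B ≤ 1 := by
  refine Real.sSup_le ?_ zero_le_one
  rintro _ ⟨v, -, hv, rfl⟩
  exact hv ▸ eta_le_norm v B

theorem eta_le_subspaceDist (hv : v ∈ A) (h1 : ‖v‖ = 1) : eta v B ≤ subspaceDist A B := by
  refine le_csSup ⟨1, ?_⟩ ⟨v, hv, h1, rfl⟩
  rintro _ ⟨w, -, hw, rfl⟩
  exact hw ▸ eta_le_norm w B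

theorem inner_le_norm_mul_subspaceDist (hv : v ∈ A) (hm : m ∈ Bᗮ) (h1 : ‖m‖ = 1) :
    inner ℝ v m ≤ ‖v‖ * subspaceDist A B := by
  rcases eq_or_ne v 0 with rfl | hv0
  · rw [inner_zero_left, norm_zero, zero_mul]
  have hunit : inner ℝ (‖v‖⁻¹ • v) m ≤ subspaceDist A B :=
    (inner_le_eta hm h1).trans
      (eta_le_subspaceDist (A.smul_mem _ hv) (norm_smul_inv_norm (𝕜 := ℝ) hv0))
  rwa [real_inner_smul_left, inv_mul_le_iff₀ (norm_pos_iff.2 hv0)] at hunit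

theorem subspaceDist_le_add_two_mul {δ : ℝ} (hδ : 0 ≤ δ)
    (h : ∀ v ∈ A, ∃ v' ∈ A', ‖v - v'‖ ≤ δ * ‖v‖) :
    subspaceDist A B ≤ subspaceDist A' B + 2 * δ := by
  have hD0 := subspaceDist_nonneg A' B
  refine Real.sSup_le ?_ (by positivity)
  rintro _ ⟨v, hv, hv1, rfl⟩
  obtain ⟨v', hv', hvv'⟩ := h v hv
  rw [hv1, mul_one] at hvv'
  refine eta_le (by positivity) fun m hm hm1 => ?_
  have hnorm : ‖v'‖ ≤ 1 + δ := by
    linarith [norm_le_norm_add_norm_sub v v']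
  calc inner ℝ v m = inner ℝ v' m + inner ℝ (v - v') m := by rw [← inner_add_left, add_sub_cancel]
    _ ≤ ‖v'‖ * subspaceDist A' B + ‖v - v'‖ :=
      add_le_add (inner_le_norm_mul_subspaceDist hv' hm hm1) (inner_le_norm_of_norm_eq_one _ hm1)
    _ ≤ (1 + δ) * subspaceDist A' B + δ := by gcongr
    _ ≤ subspaceDist A' B + 2 * δ := by
      linarith [mul_le_mul_of_nonneg_left (subspaceDist_le_one A' B) hδ]

end Angles

theorem mem_tangentConeAt_iff_forall {Y : Set (E n)} {y v : E n} :
    v ∈ tangentConeAt ℝ Y y ↔ ∀ δ : ℝ, 0 < δ → ∀ ε : ℝ, 0 < ε → ∃ c : ℝ, ∃ d : E n,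
      ‖d‖ < δ ∧ y + d ∈ Y ∧ ‖v - c • d‖ < ε := by
  rw [Metric.nhds_basis_ball.tangentConeAt_eq_biInter_closure]
  simp only [mem_iInter, Metric.mem_closure_iff, Set.mem_smul, dist_eq_norm]
  refine forall₂_congr fun δ _ => forall₂_congr fun ε _ => ⟨?_, ?_⟩
  · rintro ⟨_, ⟨c, -, d, ⟨hd, hdY⟩, rfl⟩, h⟩
    exact ⟨c, d, mem_ball_zero_iff.1 hd, hdY, h⟩
  · rintro ⟨c, d, hd, hdY, h⟩
    exact ⟨_, ⟨c, mem_univ _, d, ⟨mem_ball_zero_iff.2 hd, hdY⟩, rfl⟩, h⟩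

theorem mem_tangent_orthogonal_iff {Y : Set (E n)} {y m : E n} :
    m ∈ (tangent Y y)ᗮ ↔ ∀ v, v ∈ tangentConeAt ℝ Y y → inner ℝ v m = 0 := by
  rw [tangent, ← Submodule.span_singleton_le_iff_mem, Submodule.le_orthogonal_iff_le_orthogonal,
    Submodule.span_le]
  exact forall₂_congr fun v _ => Submodule.mem_orthogonal_singleton_iff_inner_left

theorem DefVec.mem_tangent_orthogonal {L : FirstOrder.Language.{u, v}} [L.Structure ℝ]
    [ExpandsRealField L] {α : Type*} [Finite α] {Y : Set (E n)} (hY : IsDefinable L Y)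
    {f g : (α → ℝ) → E n} (hf : DefVec L f) (hg : DefVec L g) :
    DefPred L fun w => g w ∈ (tangent Y (f w))ᗮ := by
  simp only [mem_tangent_orthogonal_iff, mem_tangentConeAt_iff_forall]
  refine .forall_vec (.imp (.forall_real (.imp (DefFun.lt (.const 0) (.coord _)) (.forall_real
    (.imp (DefFun.lt (.const 0) (.coord _)) (.exists_real (.exists_vec (.and ?near
      (.and ?mem ?approx)))))))) ?normal)
  case near => exact (DefVec.tuple _).norm.lt (.coord _)
  case mem => exact hY.mem ((hf.comp fun _ => .coord _).add (.tuple _))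
  case approx => exact ((DefVec.tuple _).sub (.smul (.coord _) (.tuple _))).norm.lt (.coord _)
  case normal => exact ((DefVec.tuple _).inner (hg.comp fun _ => .coord _)).eq (.const 0)

theorem mem_tangent_of_hasDerivAt {X : Set (E n)} {f : ℝ → E n} {f' : E n} {t : ℝ}
    (hf : HasDerivAt f f' t) (hX : ∀ᶠ s in 𝓝 t, f s ∈ X) : f' ∈ tangent X (f t) := by
  have h := (hf.hasFDerivAt.hasFDerivWithinAt (s := f ⁻¹' X)).mapsTo_tangent_cone
  rw [tangentConeAt_of_mem_nhds (show f ⁻¹' X ∈ 𝓝 t from hX)] at h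
  have hcone := h (mem_univ (1 : ℝ))
  rw [ContinuousLinearMap.toSpanSingleton_apply, one_smul] at hcone
  exact Submodule.subset_span (tangentConeAt_mono (image_preimage_subset f X) hcone)

theorem tangentConeAt_submodule_subset (V : Submodule ℝ (E n)) {z : E n} (hz : z ∈ V) :
    tangentConeAt ℝ (V : Set (E n)) z ⊆ V := by
  intro v hv
  obtain ⟨α, l, hl, c, d, -, hmem, hlim⟩ := exists_fun_of_mem_tangentConeAt hv
  refine V.closed_of_finiteDimensional.mem_of_tendsto hlim (hmem.mono fun a ha => ?_)
  exact V.smul_mem _ ((V.add_mem_iff_right hz).1 ha)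

section Chart

variable {φ : OpenPartialHomeomorph (E n) (E n)} {V : Submodule ℝ (E n)} {X : Set (E n)} {x v : E n}

theorem fderiv_symm_fderiv (hx : x ∈ φ.source) (hφ : DifferentiableAt ℝ φ x)
    (hψ : DifferentiableAt ℝ φ.symm (φ x)) (v : E n) :
    fderiv ℝ φ.symm (φ x) (fderiv ℝ φ x v) = v := by
  have hid : HasFDerivAt (φ.symm ∘ φ) (.id ℝ (E n)) x :=
    (hasFDerivAt_id x).congr_of_eventuallyEq <|
      mem_of_superset (φ.open_source.mem_nhds hx) fun _ => φ.left_inv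
  exact DFunLike.congr_fun ((hψ.hasFDerivAt.comp x hφ.hasFDerivAt).unique hid) v

theorem fderiv_mem_of_mem_tangent (hX : ∀ x ∈ φ.source, x ∈ X ↔ φ x ∈ V) (hx : x ∈ φ.source)
    (hxX : x ∈ X) (hφ : DifferentiableAt ℝ φ x) (hv : v ∈ tangent X x) : fderiv ℝ φ x v ∈ V := by
  suffices tangent X x ≤ V.comap (fderiv ℝ φ x : E n →ₗ[ℝ] E n) from this hv
  refine Submodule.span_le.2 fun w hw => ?_
  rw [← tangentConeAt_inter_nhds (φ.open_source.mem_nhds hx)] at hw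
  have himage := (hφ.hasFDerivAt.hasFDerivWithinAt (s := X ∩ φ.source)).mapsTo_tangent_cone hw
  refine tangentConeAt_submodule_subset V ((hX x hx).1 hxX) (tangentConeAt_mono ?_ himage)
  rintro _ ⟨y, hy, rfl⟩
  exact (hX y hy.2).1 hy.1

theorem fderiv_symm_mem_tangent (hX : ∀ x ∈ φ.source, x ∈ X ↔ φ x ∈ V) (hx : x ∈ φ.source)
    (hxX : x ∈ X) (hψ : DifferentiableAt ℝ φ.symm (φ x)) (hv : v ∈ V) :
    fderiv ℝ φ.symm (φ x) v ∈ tangent X x := by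
  have hline : HasDerivAt (fun s : ℝ => φ x + s • v) v 0 := by
    simpa only [one_smul, id] using ((hasDerivAt_id (0 : ℝ)).smul_const v).const_add (φ x)
  have hline0 : φ x + (0 : ℝ) • v = φ x := by rw [zero_smul, add_zero]
  have hcurve : HasDerivAt (fun s : ℝ => φ.symm (φ x + s • v)) (fderiv ℝ φ.symm (φ x) v) 0 :=
    HasFDerivAt.comp_hasDerivAt (0 : ℝ) (by rw [hline0]; exact hψ.hasFDerivAt) hline
  have hmem : ∀ᶠ s : ℝ in 𝓝 0, φ.symm (φ x + s • v) ∈ X := by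
    filter_upwards [hline.continuousAt.eventually_mem
      (φ.open_target.mem_nhds (hline0.symm ▸ φ.map_source hx))] with s hs
    rw [hX _ (φ.map_target hs), φ.right_inv hs]
    exact V.add_mem ((hX x hx).1 hxX) (V.smul_mem _ hv)
  have := mem_tangent_of_hasDerivAt hcurve hmem
  rwa [hline0, φ.left_inv hx] at this

end Chart

theorem IsC2Submanifold.exists_tangent_lipschitz {d : ℕ} {X : Set (E n)} (hX : IsC2Submanifold d X)
    {p : E n} (hp : p ∈ X) : ∃ K : ℝ, 0 ≤ K ∧ ∀ᶠ z in 𝓝 p ×ˢ 𝓝 p, z.1 ∈ X → z.2 ∈ X →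
      ∀ v ∈ tangent X z.1, ∃ v' ∈ tangent X z.2, ‖v - v'‖ ≤ K * ‖z.1 - z.2‖ * ‖v‖ := by
  obtain ⟨φ, V, hps, hφ, hψ, -, hXV⟩ := hX p hp
  have hφC : ∀ x ∈ φ.source, ContDiffAt ℝ 2 φ x := fun x hx =>
    (hφ x hx).contDiffAt (φ.open_source.mem_nhds hx)
  have hψC : ∀ x ∈ φ.source, ContDiffAt ℝ 2 φ.symm (φ x) := fun x hx =>
    (hψ _ (φ.map_source hx)).contDiffAt (φ.open_target.mem_nhds (φ.map_source hx))
  have hφd : ∀ x ∈ φ.source, DifferentiableAt ℝ φ x := fun x hx =>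
    (hφC x hx).differentiableAt two_ne_zero
  have hψd : ∀ x ∈ φ.source, DifferentiableAt ℝ φ.symm (φ x) := fun x hx =>
    (hψC x hx).differentiableAt two_ne_zero
  obtain ⟨K, U, hU, hK⟩ : ∃ K, ∃ U ∈ 𝓝 p, LipschitzOnWith K (fun x => fderiv ℝ φ.symm (φ x)) U :=
    (((hψC p hps).fderiv_right (m := 1) one_add_one_eq_two.le).comp p
      ((hφC p hps).of_le one_le_two)).exists_lipschitzOnWith
  obtain ⟨M, hM⟩ : ∃ M, ∀ᶠ x in 𝓝 p, ‖fderiv ℝ φ x‖ ≤ M :=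
    ((hφC p hps).fderiv_right (m := 1) one_add_one_eq_two.le).continuousAt.norm.isBoundedUnder_le
  refine ⟨K * M, mul_nonneg K.2 ((norm_nonneg _).trans hM.self_of_nhds), ?_⟩
  have hnear : ∀ᶠ x in 𝓝 p, x ∈ U ∧ x ∈ φ.source ∧ ‖fderiv ℝ φ x‖ ≤ M :=
    Filter.Eventually.and hU ((φ.open_source.eventually_mem hps).and hM)
  filter_upwards [hnear.prod_mk hnear]
  rintro ⟨x, x'⟩ ⟨⟨hxU, hxs, hxM⟩, hxU', hxs', -⟩ hxX hxX' v hv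
  refine ⟨fderiv ℝ φ.symm (φ x') (fderiv ℝ φ x v), fderiv_symm_mem_tangent hXV hxs' hxX'
    (hψd x' hxs') (fderiv_mem_of_mem_tangent hXV hxs hxX (hφd x hxs) hv), ?_⟩
  calc ‖v - fderiv ℝ φ.symm (φ x') (fderiv ℝ φ x v)‖
      = ‖(fderiv ℝ φ.symm (φ x) - fderiv ℝ φ.symm (φ x')) (fderiv ℝ φ x v)‖ := by
        rw [_root_.sub_apply, fderiv_symm_fderiv hxs (hφd x hxs) (hψd x hxs)]
    _ ≤ ‖fderiv ℝ φ.symm (φ x) - fderiv ℝ φ.symm (φ x')‖ * (‖fderiv ℝ φ x‖ * ‖v‖) :=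
        ContinuousLinearMap.le_opNorm_of_le _ (ContinuousLinearMap.le_opNorm _ _)
    _ ≤ (K * ‖x - x'‖) * (M * ‖v‖) := by
        gcongr
        simpa only [dist_eq_norm] using hK.dist_le_mul x hxU x' hxU'
    _ = K * M * ‖x - x'‖ * ‖v‖ := by ring

theorem IsC2Submanifold.exists_subspaceDist_tangent_le {d : ℕ} {X : Set (E n)}
    (hX : IsC2Submanifold d X) {p : E n} (hp : p ∈ X) :
    ∃ K : ℝ, 0 ≤ K ∧ ∀ᶠ z in 𝓝 p ×ˢ 𝓝 p, z.1 ∈ X → z.2 ∈ X → ∀ B : Submodule ℝ (E n),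
      subspaceDist (tangent X z.1) B ≤ subspaceDist (tangent X z.2) B + K * ‖z.1 - z.2‖ := by
  obtain ⟨K, hK0, hK⟩ := hX.exists_tangent_lipschitz hp
  refine ⟨2 * K, by positivity, hK.mono fun z hz hz1 hz2 B => ?_⟩
  rw [mul_assoc]
  exact subspaceDist_le_add_two_mul (by positivity) (hz hz1 hz2)

end Geometry

/-! ### Ratio tests at quasi-nearest points -/

section QuasiNearest

variable {n : ℕ} {X : Set (E n)} {p x y : E n} {π : E n → E n} {C : ℝ}

/-- The point `x` of `X` is, up to the factor `C`, as near to `y` as any point of `X`. -/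
def IsQuasiNearest (X : Set (E n)) (C : ℝ) (y x : E n) : Prop :=
  x ∈ X ∧ ∀ z ∈ X, ‖x - y‖ ≤ C * ‖z - y‖

/-- Near `p`, the map `π` sends every point to a quasi-nearest point of `X`, with a uniform
constant. This is what the local retractions of both kinds have in common. -/
def IsQuasiNearestMap (X : Set (E n)) (p : E n) (π : E n → E n) : Prop :=
  ∃ C, ∀ᶠ y in 𝓝 p, IsQuasiNearest X C y (π y)

theorem IsNearestPointRetraction.isQuasiNearestMap (h : IsNearestPointRetraction X p π) :
    IsQuasiNearestMap X p π := by
  refine ⟨1, h.mono fun y ⟨hπ, hdist⟩ => ⟨hπ, fun z hz => ?_⟩⟩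
  rw [one_mul, ← dist_eq_norm, ← dist_eq_norm, dist_comm, hdist, dist_comm z]
  exact Metric.infDist_le_dist_of_mem hz

theorem IsC1Retraction.isQuasiNearestMap (h : IsC1Retraction X p π) (hp : p ∈ X) :
    IsQuasiNearestMap X p π := by
  obtain ⟨hπ, hret⟩ := h
  obtain ⟨K, U, hU, hK⟩ := hπ.exists_lipschitzOnWith
  have hlip : ∀ y ∈ U, ∀ z ∈ U, π z = z → ‖π y - y‖ ≤ (K + 1) * ‖z - y‖ := fun y hy z hz hzz => by
    have := hK.dist_le_mul y hy z hz
    rw [hzz, dist_eq_norm, dist_eq_norm, norm_sub_rev y z] at this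
    linarith [norm_sub_le_norm_sub_add_norm_sub (π y) z y]
  obtain ⟨r, hr, hball⟩ := Metric.eventually_nhds_iff.1 (hret.and hU)
  refine ⟨K + 1, Metric.eventually_nhds_iff.2 ⟨r / 2, half_pos hr, fun y hy => ?_⟩⟩
  obtain ⟨⟨hyX, -⟩, hyU⟩ := hball (hy.trans (half_lt_self hr))
  have hfix : ∀ z ∈ X, dist z p < r → ‖π y - y‖ ≤ (K + 1) * ‖z - y‖ := fun z hz hzr =>
    hlip y hyU z (hball hzr).2 ((hball hzr).1.2 hz)
  refine ⟨hyX, fun z hz => ?_⟩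
  rcases lt_or_ge (dist z p) r with hzr | hzr
  · exact hfix z hz hzr
  · have hfar : ‖p - y‖ ≤ ‖z - y‖ := by
      rw [← dist_eq_norm, ← dist_eq_norm, dist_comm p]
      linarith [dist_triangle z y p]
    exact (hfix p hp (by rwa [dist_self])).trans (by gcongr)

theorem IsLocalRetraction.isQuasiNearestMap (h : IsLocalRetraction X p π) (hp : p ∈ X) :
    IsQuasiNearestMap X p π :=
  h.elim (·.isQuasiNearestMap) (·.isQuasiNearestMap hp)

theorem IsQuasiNearest.norm_sub_le (h : IsQuasiNearest X C y x) (hp : p ∈ X) :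
    ‖x - p‖ ≤ (C + 1) * ‖y - p‖ := by
  have := h.2 p hp
  rw [norm_sub_rev p] at this
  linarith [norm_sub_le_norm_sub_add_norm_sub x y p]

theorem eventually_forall_isQuasiNearest (hp : p ∈ X) (C : ℝ) {P : E n → Prop}
    (h : ∀ᶠ x in 𝓝 p, P x) : ∀ᶠ y in 𝓝 p, ∀ x, IsQuasiNearest X C y x → P x := by
  obtain ⟨r, hr, hball⟩ := Metric.eventually_nhds_iff.1 h
  have hlim : Tendsto (fun y => (C + 1) * ‖y - p‖) (𝓝 p) (𝓝 0) := by
    simpa only [mul_zero] using (tendsto_norm_sub_self p).const_mul (C + 1)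
  filter_upwards [hlim.eventually_lt_const hr] with y hy x hx
  exact hball (by rw [dist_eq_norm]; exact (hx.norm_sub_le hp).trans_lt hy)

end QuasiNearest

section RatioTests

variable {n : ℕ} {X Y : Set (E n)} {p x y z : E n} {π : E n → E n} {C K : ℝ}

theorem verdierRatio_nonneg (Y X : Set (E n)) (y x : E n) : 0 ≤ verdierRatio Y X y x :=
  div_nonneg (subspaceDist_nonneg _ _) (norm_nonneg _)

theorem kuoRatio_eq (Y X : Set (E n)) (p : E n) (π : E n → E n) (y : E n) :
    kuoRatio Y X p π y = ‖y - p‖ * verdierRatio Y X y (π y) :=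
  mul_div_assoc _ _ _

theorem IsQuasiNearest.verdierRatio_le (hz : IsQuasiNearest X C y z) (hx : x ∈ X) (hy : y ∉ X)
    (hK : 0 ≤ K) (hxz : subspaceDist (tangent X x) (tangent Y y) ≤
      subspaceDist (tangent X z) (tangent Y y) + K * ‖x - z‖) :
    verdierRatio Y X y x ≤ C * verdierRatio Y X y z + K * (1 + C) := by
  have hxpos : 0 < ‖x - y‖ := norm_sub_pos_iff.2 (ne_of_mem_of_not_mem hx hy)
  have hzpos : 0 < ‖z - y‖ := norm_sub_pos_iff.2 (ne_of_mem_of_not_mem hz.1 hy)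
  have hnear : ‖z - y‖ ≤ C * ‖x - y‖ := hz.2 x hx
  have htri : ‖x - z‖ ≤ (1 + C) * ‖x - y‖ := by
    linarith [norm_sub_le_norm_sub_add_norm_sub x y z, norm_sub_rev y z]
  have hzratio : subspaceDist (tangent X z) (tangent Y y) = verdierRatio Y X y z * ‖z - y‖ :=
    (div_mul_cancel₀ _ hzpos.ne').symm
  refine (div_le_iff₀ hxpos).2 (hxz.trans ?_)
  calc subspaceDist (tangent X z) (tangent Y y) + K * ‖x - z‖
      ≤ verdierRatio Y X y z * (C * ‖x - y‖) + K * ((1 + C) * ‖x - y‖) := by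
        rw [hzratio]
        have := verdierRatio_nonneg Y X y z
        gcongr
    _ = (C * verdierRatio Y X y z + K * (1 + C)) * ‖x - y‖ := by ring

/-- The ratio test for all quasi-nearest points at once instead of the values of one retraction.
Both (r), on a `C²` submanifold, and (w) imply it, and it has definable data only: a local
retraction need not be definable. -/
def UniformRatioTest (Y X : Set (E n)) (p : E n) : Prop :=
  ∀ C, ∀ ε > 0, ∀ᶠ y in 𝓝[Y] p, ∀ x, IsQuasiNearest X C y x → ‖y - p‖ * verdierRatio Y X y x < ε

theorem ConditionR.uniformRatioTest {d : ℕ} (h : ConditionR Y X p π) (hX : IsC2Submanifold d X)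
    (hXY : Disjoint X Y) (hp : p ∈ X) (hπ : IsQuasiNearestMap X p π) : UniformRatioTest Y X p := by
  intro C ε hε
  obtain ⟨C', hC'⟩ := hπ
  obtain ⟨K, hK0, hK⟩ := hX.exists_subspaceDist_tangent_le hp
  obtain ⟨P, hP, Q, hQ, hPQ⟩ := eventually_prod_iff.1 hK
  have hlim : Tendsto (fun y => C' * kuoRatio Y X p π y + K * (1 + C') * ‖y - p‖)
      (𝓝[Y] p) (𝓝 0) := by
    simpa only [mul_zero, add_zero] using (h.const_mul C').add
      (((tendsto_norm_sub_self p).mono_left nhdsWithin_le_nhds).const_mul (K * (1 + C')))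
  filter_upwards [self_mem_nhdsWithin, nhdsWithin_le_nhds hC', hlim.eventually_lt_const hε,
    nhdsWithin_le_nhds (eventually_forall_isQuasiNearest hp C hP),
    nhdsWithin_le_nhds (eventually_forall_isQuasiNearest hp C' hQ)]
    with y hyY hπy hlt hPy hQy x hx
  have hratio : verdierRatio Y X y x ≤ C' * verdierRatio Y X y (π y) + K * (1 + C') :=
    hπy.verdierRatio_le hx.1 (hXY.notMem_of_mem_right hyY) hK0
      (hPQ (hPy x hx) (hQy _ hπy) hx.1 hπy.1 _)
  calc ‖y - p‖ * verdierRatio Y X y x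
      ≤ ‖y - p‖ * (C' * verdierRatio Y X y (π y) + K * (1 + C')) := by gcongr
    _ = C' * kuoRatio Y X p π y + K * (1 + C') * ‖y - p‖ := by rw [kuoRatio_eq]; ring
    _ < ε := hlt

theorem ConditionW.uniformRatioTest (h : ConditionW Y X p) (hp : p ∈ X) :
    UniformRatioTest Y X p := by
  intro C ε hε
  obtain ⟨M, U, hU, hM⟩ := h
  have hlim : Tendsto (fun y => ‖y - p‖ * M) (𝓝[Y] p) (𝓝 0) := by
    simpa only [zero_mul] using
      ((tendsto_norm_sub_self p).mono_left nhdsWithin_le_nhds).mul_const M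
  filter_upwards [self_mem_nhdsWithin, nhdsWithin_le_nhds hU, hlim.eventually_lt_const hε,
    nhdsWithin_le_nhds (eventually_forall_isQuasiNearest hp C hU)] with y hyY hyU hlt hxU x hx
  exact (mul_le_mul_of_nonneg_left (hM y ⟨hyY, hyU⟩ x ⟨hx.1, hxU x hx⟩)
    (norm_nonneg _)).trans_lt hlt

theorem UniformRatioTest.conditionR (h : UniformRatioTest Y X p) (hπ : IsQuasiNearestMap X p π) :
    ConditionR Y X p π := by
  obtain ⟨C, hC⟩ := hπ
  refine Metric.tendsto_nhds.2 fun ε hε => ?_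
  filter_upwards [h C ε hε, nhdsWithin_le_nhds hC] with y hy hπy
  rw [dist_zero_right, kuoRatio_eq,
    Real.norm_of_nonneg (mul_nonneg (norm_nonneg _) (verdierRatio_nonneg _ _ _ _))]
  exact hy _ hπy

theorem ConditionR.tendsto_alpha (h : ConditionR Y X p π) (hXY : Disjoint X Y) (hp : p ∈ X)
    (hπ : IsQuasiNearestMap X p π) : Tendsto (alpha Y X π) (𝓝[Y] p) (𝓝 0) := by
  obtain ⟨C, hC⟩ := hπ
  have hlim : Tendsto (fun y => C * kuoRatio Y X p π y) (𝓝[Y] p) (𝓝 0) := by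
    simpa only [mul_zero] using h.const_mul C
  refine tendsto_of_tendsto_of_tendsto_of_le_of_le' tendsto_const_nhds hlim
    (.of_forall fun y => subspaceDist_nonneg _ _) ?_
  filter_upwards [self_mem_nhdsWithin, nhdsWithin_le_nhds hC] with y hyY hπy
  have hpos : 0 < ‖π y - y‖ :=
    norm_sub_pos_iff.2 (ne_of_mem_of_not_mem hπy.1 (hXY.notMem_of_mem_right hyY))
  have hnear : ‖π y - y‖ ≤ C * ‖y - p‖ := norm_sub_rev p y ▸ hπy.2 p hp
  calc alpha Y X π y = ‖π y - y‖ * verdierRatio Y X y (π y) := (mul_div_cancel₀ _ hpos.ne').symm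
    _ ≤ C * ‖y - p‖ * verdierRatio Y X y (π y) :=
      mul_le_mul_of_nonneg_right hnear (verdierRatio_nonneg _ _ _ _)
    _ = C * kuoRatio Y X p π y := by rw [kuoRatio_eq, mul_assoc]

end RatioTests

/-! ### Whitney regularity from the uniform ratio test -/

section SecantCurves

variable {L : FirstOrder.Language.{u, v}} [L.Structure ℝ] {n : ℕ} {X Y : Set (E n)} {p : E n}

theorem inner_sub_le_mul_subspaceDist {x y : ℝ → E n} {x' y' m : E n} {t : ℝ}
    (hx : HasDerivAt x x' t) (hy : HasDerivAt y y' t) (hxX : ∀ᶠ s in 𝓝 t, x s ∈ X)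
    (hyY : ∀ᶠ s in 𝓝 t, y s ∈ Y) (hm : m ∈ (tangent Y (y t))ᗮ) (h1 : ‖m‖ = 1) :
    inner ℝ (x' - y') m ≤ ‖x'‖ * subspaceDist (tangent X (x t)) (tangent Y (y t)) := by
  have hy' : inner ℝ y' m = 0 :=
    Submodule.inner_right_of_mem_orthogonal (mem_tangent_of_hasDerivAt hy hyY) hm
  rw [inner_sub_left, hy', sub_zero]
  exact inner_le_norm_mul_subspaceDist (mem_tangent_of_hasDerivAt hx hxX) hm h1

/-- A secant of `X` and `Y`, from `y ∈ Y` to a quasi-nearest point `x` of `X`, which the unit normal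
`m` of `Y` at `y` witnesses to make an angle of sine at least `ε` with `T_y Y`. -/
structure IsSeparatedSecant (Y X : Set (E n)) (C ε : ℝ) (y x m : E n) : Prop where
  mem : y ∈ Y
  isQuasiNearest : IsQuasiNearest X C y x
  mem_normal : m ∈ (tangent Y y)ᗮ
  norm_eq_one : ‖m‖ = 1
  le_inner : ε * ‖x - y‖ ≤ inner ℝ (x - y) m

theorem IsOMinimal.exists_frequently_le_mul_verdierRatio (hL : IsOMinimal L) (hXY : Disjoint X Y)
    (hp : p ∈ X) {C ε : ℝ} (hε : 0 < ε) {x y m : ℝ → E n} (hx : DefCurve L x) (hy : DefCurve L y)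
    (hm : DefCurve L m) (hyp : ∀ᶠ t in 𝓝[>] 0, ‖y t - p‖ = t)
    (hsec : ∀ᶠ t in 𝓝[>] 0, IsSeparatedSecant Y X C ε (y t) (x t) (m t)) :
    ∃ c > 0, ∃ᶠ t in 𝓝[>] 0, c ≤ t * verdierRatio Y X (y t) (x t) := by
  have := hL.expandsRealField
  have hxp : ∀ᶠ t in 𝓝[>] 0, ‖x t - p‖ ≤ (C + 1) * t := by
    filter_upwards [hyp, hsec] with t ht hs
    simpa only [ht] using hs.isQuasiNearest.norm_sub_le hp
  have hxy : ∀ᶠ t in 𝓝[>] 0, ‖x t - y t‖ ≤ C * t := by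
    filter_upwards [hyp, hsec] with t ht hs
    simpa only [norm_sub_rev p, ht] using hs.isQuasiNearest.2 p hp
  have hne : ∀ᶠ t in 𝓝[>] 0, x t - y t ≠ 0 := by
    filter_upwards [hsec] with t hs using
      sub_ne_zero.2 (hXY.ne_of_mem hs.isQuasiNearest.1 hs.mem)
  have hgrowth := hL.eventually_norm_le_mul_inner_deriv (hx.sub hy) hm hε hne hxy
    (hsec.mono fun _ => (·.norm_eq_one)) (hsec.mono fun _ => (·.le_inner))
  have hspeed := hL.eventually_norm_deriv_le (hx.sub (.const p)) (G := fun t => t) (.coord 0)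
    (tendsto_id'.2 nhdsWithin_le_nhds) hxp
  set D : ℝ := |n * (C + 1)| + 1
  have hD0 : 0 < D := by positivity
  refine ⟨ε / 8 / D, by positivity, (hL.frequently_differentiableAt hx hy 0).mp ?_⟩
  filter_upwards [hgrowth, hspeed, hne, hsec, self_mem_nhdsWithin,
    eventually_eventually_nhdsWithin.2 hsec] with t hgrow hspeed hne hs ht hnear ⟨hxt, hyt⟩
  rw [nhdsWithin_eq_nhds.2 (Ioi_mem_nhds ht)] at hnear
  have hx' : ‖deriv x t‖ ≤ D := by
    have := hspeed _ 1 (hxt.hasDerivAt.sub_const p) (hasDerivAt_id t)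
    linarith [le_abs_self (n * (C + 1))]
  have hnormal := inner_sub_le_mul_subspaceDist hxt.hasDerivAt hyt.hasDerivAt
    (hnear.mono fun _ h => h.isQuasiNearest.1) (hnear.mono fun _ h => h.mem) hs.mem_normal
    hs.norm_eq_one
  rw [verdierRatio, ← mul_div_assoc, div_le_iff₀ hD0, div_mul_eq_mul_div,
    le_div_iff₀ (norm_pos_iff.2 hne)]
  have ht0 : 0 ≤ t := le_of_lt ht
  have hdist := subspaceDist_nonneg (tangent X (x t)) (tangent Y (y t))
  calc ε / 8 * ‖x t - y t‖
      ≤ t * inner ℝ (deriv x t - deriv y t) (m t) := hgrow _ (hxt.hasDerivAt.sub hyt.hasDerivAt)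
    _ ≤ t * (D * subspaceDist (tangent X (x t)) (tangent Y (y t))) := by
      gcongr
      exact hnormal.trans (by gcongr)
    _ = t * subspaceDist (tangent X (x t)) (tangent Y (y t)) * D := by ring

theorem IsDefinable.isQuasiNearest [ExpandsRealField L] {α : Type*} [Finite α]
    (hX : IsDefinable L X) {f g : (α → ℝ) → E n} (C : ℝ) (hf : DefVec L f) (hg : DefVec L g) :
    DefPred L fun w => IsQuasiNearest X C (f w) (g w) :=
  (hX.mem hg).and (.forall_vec (.imp (hX.mem (.tuple _))
    (((hg.comp fun _ => .coord _).sub (hf.comp fun _ => .coord _)).norm.le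
      (.mul (.const C) ((DefVec.tuple _).sub (hf.comp fun _ => .coord _)).norm))))

theorem IsDefinable.isSeparatedSecant [ExpandsRealField L] {α : Type*} [Finite α]
    (hX : IsDefinable L X) (hY : IsDefinable L Y) {f g h : (α → ℝ) → E n} (C ε : ℝ)
    (hf : DefVec L f) (hg : DefVec L g) (hh : DefVec L h) :
    DefPred L fun w => IsSeparatedSecant Y X C ε (f w) (g w) (h w) :=
  ((hY.mem hf).and ((hX.isQuasiNearest C hf hg).and ((hf.mem_tangent_orthogonal hY hh).and
    ((hh.norm.eq (.const 1)).and
      ((DefFun.const ε |>.mul (hg.sub hf).norm).le ((hg.sub hf).inner hh)))))).congr fun _ =>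
    ⟨fun ⟨h1, h2, h3, h4, h5⟩ => ⟨h1, h2, h3, h4, h5⟩,
      fun ⟨h1, h2, h3, h4, h5⟩ => ⟨h1, h2, h3, h4, h5⟩⟩

theorem IsOMinimal.exists_separatedSecant_curve (hL : IsOMinimal L) (hX : IsDefinable L X)
    (hY : IsDefinable L Y) (hpY : p ∉ Y) {C ε : ℝ}
    (h : ∃ᶠ y in 𝓝[Y] p, ∃ x m, IsSeparatedSecant Y X C ε y x m) :
    ∃ x y m : ℝ → E n, DefCurve L x ∧ DefCurve L y ∧ DefCurve L m ∧
      ∀ᶠ t in 𝓝[>] 0, ‖y t - p‖ = t ∧ IsSeparatedSecant Y X C ε (y t) (x t) (m t) := by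
  have := hL.expandsRealField
  let vec (w : Fin 3 × Fin n → ℝ) (j : Fin 3) : E n := WithLp.toLp 2 fun i => w (j, i)
  have hvec (j) : DefVec L fun w => vec w j := .tuple fun i => (j, i)
  have hlim : Tendsto (fun y => ‖y - p‖) (𝓝[Y] p) (𝓝[>] 0) :=
    (tendsto_norm_sub_self_nhdsNE p).mono_left
      (nhdsWithin_mono p fun y hy => ne_of_mem_of_not_mem hy hpY)
  obtain ⟨γ, hγ, hsel⟩ := hL.exists_definable_selection
    (hX.isSeparatedSecant hY C ε (hvec 0) (hvec 1) (hvec 2)) ((hvec 0).sub (.const p)).norm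
    (hlim.frequently (h.mono fun y ⟨x, m, hs⟩ => ⟨fun ji => ![y, x, m] ji.1 ji.2, rfl, hs⟩))
  exact ⟨fun t => vec (γ t) 1, fun t => vec (γ t) 0, fun t => vec (γ t) 2,
    fun i => hγ (1, i), fun i => hγ (0, i), fun i => hγ (2, i), hsel⟩

theorem frequently_exists_isSeparatedSecant {π : E n → E n} {C ε : ℝ} (hXY : Disjoint X Y)
    (hπ : ∀ᶠ y in 𝓝 p, IsQuasiNearest X C y (π y)) (hε : 0 ≤ ε)
    (h : ∃ᶠ y in 𝓝[Y] p, ε < beta Y π y) :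
    ∃ᶠ y in 𝓝[Y] p, ∃ x m, IsSeparatedSecant Y X C ε y x m := by
  refine h.mp ?_
  filter_upwards [self_mem_nhdsWithin, nhdsWithin_le_nhds hπ] with y hyY hπy hβ
  obtain ⟨m, hm, hm1, hlt⟩ := exists_normal_of_lt_eta hε hβ
  refine ⟨π y, m, hyY, hπy, hm, hm1, ?_⟩
  have hpos : 0 < ‖π y - y‖ := norm_sub_pos_iff.2 (hXY.ne_of_mem hπy.1 hyY)
  rw [real_inner_smul_left, inv_mul_eq_div, lt_div_iff₀ hpos] at hlt
  exact hlt.le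

theorem UniformRatioTest.tendsto_beta (h : UniformRatioTest Y X p) (hL : IsOMinimal L)
    (hX : IsDefinable L X) (hY : IsDefinable L Y) (hXY : Disjoint X Y) (hp : p ∈ X)
    {π : E n → E n} (hπ : IsQuasiNearestMap X p π) : Tendsto (beta Y π) (𝓝[Y] p) (𝓝 0) := by
  obtain ⟨C, hC⟩ := hπ
  by_contra hβ
  obtain ⟨ε, hε, hfreq⟩ : ∃ ε > 0, ∃ᶠ y in 𝓝[Y] p, ε < beta Y π y := by
    contrapose! hβ
    refine Metric.tendsto_nhds.2 fun ε hε => ?_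
    filter_upwards [hβ (ε / 2) (half_pos hε)] with y hy
    have hβ0 : 0 ≤ beta Y π y := eta_nonneg _ _
    rw [dist_zero_right, Real.norm_of_nonneg hβ0]
    linarith
  obtain ⟨x, y, m, hx, hy, hm, hsec⟩ := hL.exists_separatedSecant_curve hX hY
    (hXY.notMem_of_mem_left hp) (frequently_exists_isSeparatedSecant hXY hC hε.le hfreq)
  obtain ⟨c, hc, hbig⟩ := hL.exists_frequently_le_mul_verdierRatio hXY hp hε hx hy hm
    (hsec.mono fun _ => And.left) (hsec.mono fun _ => And.right)
  have hlim : Tendsto y (𝓝[>] 0) (𝓝[Y] p) := by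
    refine tendsto_nhdsWithin_iff.2 ⟨tendsto_iff_norm_sub_tendsto_zero.2 ?_, ?_⟩
    · exact (tendsto_id'.2 nhdsWithin_le_nhds).congr' (hsec.mono fun t ht => ht.1.symm)
    · exact hsec.mono fun t ht => ht.2.mem
  obtain ⟨t, hct, hsmall, hyp, hs⟩ :=
    (hbig.and_eventually ((hlim.eventually (h C c hc)).and hsec)).exists
  exact hct.not_gt (by simpa only [hyp] using hsmall _ hs.isQuasiNearest)

theorem UniformRatioTest.conditionB (h : UniformRatioTest Y X p) (hL : IsOMinimal L)
    (hX : IsDefinable L X) (hY : IsDefinable L Y) (hXY : Disjoint X Y) (hp : p ∈ X)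
    {π : E n → E n} (hπ : IsQuasiNearestMap X p π) : ConditionB Y X p π :=
  ⟨(h.conditionR hπ).tendsto_alpha hXY hp hπ, h.tendsto_beta hL hX hY hXY hp hπ⟩

end SecantCurves

end Strata

theorem proposition3p2_general {L : FirstOrder.Language.{u, v}} [L.Structure ℝ]
    (hL : Strata.IsOMinimal L) {n : ℕ} {X Y : Set (Strata.E n)} (hX : Strata.IsDefinable L X)
    (hY : Strata.IsDefinable L Y) (hXY : Disjoint X Y) {p : Strata.E n} (hp : p ∈ X)
    {π : Strata.E n → Strata.E n} (hπ : Strata.IsQuasiNearestMap X p π) :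
    ((∃ d, Strata.IsC2Submanifold d X) → Strata.ConditionR Y X p π → Strata.ConditionB Y X p π) ∧
      (Strata.ConditionW Y X p → Strata.ConditionB Y X p π) :=
  ⟨fun ⟨_, hd⟩ hR => (hR.uniformRatioTest hd hXY hp hπ).conditionB hL hX hY hXY hp hπ,
    fun hW => (hW.uniformRatioTest hp).conditionB hL hX hY hXY hp hπ⟩

theorem proposition3p2 (L : FirstOrder.Language.{u, v}) [L.Structure ℝ]
    (hL : Strata.IsOMinimal L) (n : ℕ) :
    -- (r) implies (b) at each point of `X`
    (∀ (X Y : Set (Strata.E n)) (dX dY : ℕ),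
      Strata.IsDefinable L X → Strata.IsDefinable L Y →
      Strata.IsC2Submanifold dX X → Strata.IsC2Submanifold dY Y → Disjoint X Y →
      ∀ p ∈ X, ∀ π : Strata.E n → Strata.E n, Strata.IsLocalRetraction X p π →
        Strata.ConditionR Y X p π → Strata.ConditionB Y X p π) ∧
    -- (w) implies (b) for definable stratifications
    (∀ (S : Set (Strata.E n)) (strata : Set (Set (Strata.E n))),
      Strata.IsDefinableStratification L S strata →
      ∀ X ∈ strata, ∀ Y ∈ strata, X ≠ Y →
      ∀ p ∈ X, Strata.ConditionW Y X p →
        ∀ π : Strata.E n → Strata.E n, Strata.IsLocalRetraction X p π →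
          Strata.ConditionB Y X p π) := by
  exact ⟨fun X Y dX _ hX hY hdX _ hXY p hp π hπ =>
      (proposition3p2_general hL hX hY hXY hp (hπ.isQuasiNearestMap hp)).1 ⟨dX, hdX⟩,
    fun _ _ hS X hX Y hY hne p hp hW π hπ =>
      (proposition3p2_general hL (hS.definable X hX) (hS.definable Y hY)
        (hS.pairwise_disjoint X hX Y hY hne) hp (hπ.isQuasiNearestMap hp)).2 hW⟩
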